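/- Let $\mathbb{K}=\mathbb{C}$ (or $\mathbb{K}=\mathbb{R}$), let $A$ be a set (the alphabet), and let $\mathcal{W}$ be the set of all words $w=\ell_1\cdots\ell_n$ with letters in $A$, including the empty word $\emptyset$. Let $f_\ell:\mathbb{K}^D\to\mathbb{K}^D$ ($\ell\in A$) and $g_1,\dots,g_d:\mathbb{K}^D\to\mathbb{K}^D$ be smooth (holomorphic if $\mathbb{K}=\mathbb{C}$, $C^\infty$ if $\mathbb{K}=\mathbb{R}$). With the bracket $[g,f]=f'g-g'f$, assume that $g_1,\dots,g_d$ are linearly independent, that $[g_j,g_k]=0$ for $j\ne k$, and that $[g_j,f_\ell]=\nu_{j,\ell}f_\ell$ with $\nu_{j,\ell}\in\mathbb{K}$ for all $j$ and $\ell$. *Word series.* Put $f_\emptyset(x)=x$ and, for a letter $\ell$ and a word $w$, $f_{\ell w}(x)=f_w'(x)f_\ell(x)$. For $\delta\in\mathbb{K}^{\mathcal W}$ let $W_\delta(x)=\sum_{w}\delta_w f_w(x)$. This is a formal series: $f_\ell$ is replaced by $\varepsilon_\ell f_\ell$ with commuting formal parameters $\varepsilon_\ell$, $\ell\in A$, so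 that $W_\delta(x)$ is a vector of power series in the parameters; equality means equality of the coefficients of every monomial. Derivatives of series are taken term by term, and a formal series $x+h$, where $h$ has no constant term, is substituted in a smooth map through the map's Taylor expansion at $x$. With $w\sqcup\!\sqcup w'=\sum_j w_j$ denoting the shuffle product, $\mathcal{G}$ is the set of $\gamma\in\mathbb{K}^{\mathcal W}$ with $\gamma_\emptyset=1$ and $\gamma_w\gamma_{w'}=\sum_j\gamma_{w_j}$ for all $w,w'$, and $\mathfrak{g}$ is the set of $\beta\in\mathbb{K}^{\mathcal W}$ with $\beta_\emptyset=0$ and $\sum_j\beta_{w_j}=0$ for all nonempty $w,w'$. *Operators and flow.* For $v\in\mathbb{K}^d$ let $g^v=\sum_j v_jg_j$ and $\nu^v_{\ell_1\cdots\ell_n}=\sum_{i=1}^n\sum_{j=1}^d v_j\nu_{j,\ell_i}$ (with $\nu^v_\emptyset=0$), and let $(\xi_v\delta)_w=\nu^v_w\delta_w$ and $(\Xi_v\delta)_w=e^{\nu^v_w}\delta_w$. Let $U_v\subseteq\mathbb{K}^D$ be the set of points from which the solution of $\dot x=g^v(x)$ exists for $0\le t\le 1$, and let $\varphi_v:U_v\to\mathbb{K}^D$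 be the flow of $g^v$ at time $1$. Then, for every $v\in\mathbb{K}^d$, the set $U_v$ is open, $\varphi_v$ is smooth on it with invertible Jacobian matrix $\varphi_v'(x)$, and the following holds. For every $\beta\in\mathfrak{g}$, $$[g^v,W_\beta](x)=W_{\xi_v\beta}(x)\quad(x\in\mathbb{K}^D),\qquad \varphi_v'(x)^{-1}\,W_\beta(\varphi_v(x))=W_{\Xi_v\beta}(x)\quad(x\in U_v).$$ For every $\gamma\in\mathcal{G}$, $$W_\gamma(\varphi_v(x))=\varphi_v\bigl(W_{\Xi_v\gamma}(x)\bigr)\quad(x\in U_v),$$ and, for all $x\in\mathbb{K}^D$, the matrix $W_\gamma'(x)$ is invertible over the ring of power series in the parameters, and $$W_\gamma'(x)^{-1}\,g^v(W_\gamma(x))=g^v(x)-W_\gamma'(x)^{-1}\,W_{\xi_v\gamma}(x).$$ -/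

import Mathlib

open scoped ContDiff

noncomputable section

namespace WordSeries

section Words

/-! ### Words, shuffles, coefficients -/

variable {A : Type*} {K : Type*} [CommRing K]

/-- The shuffle product of two words, as the list (with multiplicities) of its terms. -/
def shuffle : List A → List A → List (List A)
  | [], w => [w]
  | u, [] => [u]
  | a :: u, b :: w =>
      (shuffle u (b :: w)).map (fun z => a :: z) ++ (shuffle (a :: u) w).map (fun z => b :: z)
  termination_by u w => u.length + w.length

variable (A K) in
/-- The set `𝒢` of coefficient families satisfying the shuffle relations. -/
def groupG : Set (List A → K) :=
  {γ | γ [] = 1 ∧ ∀ w w' : List A, γ w * γ w' = ((shuffle w w').map γ).sum}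

variable (A K) in
/-- The set `𝔤` of coefficient families that vanish at the empty word and on every shuffle of two
nonempty words. -/
def algebraG : Set (List A → K) :=
  {β | β [] = 0 ∧ ∀ w w' : List A, w ≠ [] → w' ≠ [] → ((shuffle w w').map β).sum = 0}

open Classical in
/-- The finite set of the words whose letters, counted with multiplicity, are given by `m`. -/
def wordsOf (m : A →₀ ℕ) : Finset (List A) :=
  (Finsupp.toMultiset m).lists.toFinset

theorem mem_wordsOf (m : A →₀ ℕ) (w : List A) :
    w ∈ wordsOf m ↔ (w : Multiset A) = Finsupp.toMultiset m := by
  classical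
  rw [wordsOf, Multiset.mem_toFinset, Multiset.mem_lists_iff]
  exact eq_comm

/-- `ν^v_w`: the sum over the letters `ℓ` of `w` of `ν^v_ℓ = ∑ j, v j * ν j ℓ`. -/
def nuWord {d : ℕ} (ν : Fin d → A → K) (v : Fin d → K) (w : List A) : K :=
  (w.map (fun l => ∑ j, v j * ν j l)).sum

/-- The diagonal operator `ξ_v`. -/
def xiOp {d : ℕ} (ν : Fin d → A → K) (v : Fin d → K) (δ : List A → K) : List A → K :=
  fun w => nuWord ν v w * δ w

end Words

section Fields

variable {𝕜 : Type*} [RCLike 𝕜] {A : Type*} {D d : ℕ}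

/-- The diagonal operator `Ξ_v`. -/
def XiOp (ν : Fin d → A → 𝕜) (v : Fin d → 𝕜) (δ : List A → 𝕜) : List A → 𝕜 :=
  fun w => NormedSpace.exp (nuWord ν v w) * δ w

/-- The word basis functions: `f_∅` is the identity map and
`f_{ℓ w}(x) = f_w'(x) f_ℓ(x)`. -/
def wordBasis (f : A → (Fin D → 𝕜) → (Fin D → 𝕜)) : List A → (Fin D → 𝕜) → (Fin D → 𝕜)
  | [] => id
  | l :: w => fun x => fderiv 𝕜 (wordBasis f w) x (f l x)

/-- For a word with a single letter the basis function is the given map. -/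
theorem wordBasis_singleton (f : A → (Fin D → 𝕜) → (Fin D → 𝕜)) (l : A) :
    wordBasis f [l] = f l := by
  funext x
  simp [wordBasis]

/-- The vector field `g^v = ∑ j, v j • g j`. -/
def gField (g : Fin d → (Fin D → 𝕜) → (Fin D → 𝕜)) (v : Fin d → 𝕜) (x : Fin D → 𝕜) :
    Fin D → 𝕜 :=
  ∑ j, v j • g j x

/-! ### Flows -/

/-- The points from which the solution of `c' = G c` exists on the time interval `[0, 1]`. -/
def flowDomain (G : (Fin D → 𝕜) → (Fin D → 𝕜)) : Set (Fin D → 𝕜) :=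
  {x | ∃ c : ℝ → (Fin D → 𝕜), c 0 = x ∧ IsIntegralCurveOn c (fun _ => G) (Set.Icc 0 1)}

open Classical in
/-- The flow of `G` at time `1`: the value at `t = 1` of the solution of `c' = G c`, `c 0 = x`. It
is meaningful on `flowDomain G`; elsewhere it is given the value `x`. -/
def timeOneFlow (G : (Fin D → 𝕜) → (Fin D → 𝕜)) (x : Fin D → 𝕜) : Fin D → 𝕜 :=
  if h : ∃ c : ℝ → (Fin D → 𝕜), c 0 = x ∧ IsIntegralCurveOn c (fun _ => G) (Set.Icc 0 1) then
    h.choose 1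
  else x

/-- The value of the flow does not depend on the choice of the solution. -/
theorem timeOneFlow_eq {G : (Fin D → 𝕜) → (Fin D → 𝕜)} (hG : ContDiff 𝕜 1 G)
    {c : ℝ → (Fin D → 𝕜)} (hc : IsIntegralCurveOn c (fun _ => G) (Set.Icc 0 1)) :
    timeOneFlow G (c 0) = c 1 := by
  have hex : ∃ b : ℝ → (Fin D → 𝕜), b 0 = c 0 ∧
      IsIntegralCurveOn b (fun _ => G) (Set.Icc 0 1) := ⟨c, rfl, hc⟩
  rw [timeOneFlow, dif_pos hex]
  obtain ⟨h0, hb⟩ := hex.choose_spec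
  set b := hex.choose
  have hcpt : IsCompact (b '' Set.Icc 0 1 ∪ c '' Set.Icc 0 1) :=
    (isCompact_Icc.image_of_continuousOn hb.continuousOn).union
      (isCompact_Icc.image_of_continuousOn hc.continuousOn)
  have hL : LocallyLipschitz G := fun x =>
    (hG.contDiffAt (x := x)).exists_lipschitzOnWith
  obtain ⟨K, hK⟩ := hL.locallyLipschitzOn.exists_lipschitzOnWith_of_compact hcpt
  have := ODE_solution_unique_of_mem_Icc_right (v := fun _ => G)
    (s := fun _ => b '' Set.Icc 0 1 ∪ c '' Set.Icc 0 1) (K := K) (a := 0) (b := 1)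
    (f := b) (g := c) (fun _ _ => hK) hb.continuousOn
    (fun t ht => (hb t ⟨ht.1, ht.2.le⟩).mono_of_mem_nhdsWithin (Icc_mem_nhdsGE_of_mem ht))
    (fun t ht => Or.inl ⟨t, ⟨ht.1, ht.2.le⟩, rfl⟩) hc.continuousOn
    (fun t ht => (hc t ⟨ht.1, ht.2.le⟩).mono_of_mem_nhdsWithin (Icc_mem_nhdsGE_of_mem ht))
    (fun t ht => Or.inr ⟨t, ⟨ht.1, ht.2.le⟩, rfl⟩) h0
  exact this ⟨zero_le_one, le_rfl⟩

/-! ### Formal series of maps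

Formal series are handled by attaching to every letter `ℓ` a formal parameter `ε_ℓ`, i.e. by
writing `ε_ℓ f_ℓ` for `f_ℓ`; the parameters commute with each other. The term of a word `w` is
then multiplied by the product of the parameters of its letters, and a formal series of maps is a
power series in the parameters whose coefficients are maps. Two formal series are equal if the
coefficients of each monomial are. The values of such series at a point are vectors of power
series in the parameters. -/

variable (𝕜 A D) in
/-- Power series in the parameters `ε_ℓ`, `ℓ ∈ A`, with coefficients maps `𝕜^D → 𝕜^D`. -/
abbrev FormalMap : Type _ := (A →₀ ℕ) → (Fin D → 𝕜) → (Fin D → 𝕜)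

variable (𝕜 A D) in
/-- Vectors with `D` components whose entries are power series in the parameters. -/
abbrev FormalVec : Type _ := Fin D → MvPowerSeries A 𝕜

namespace FormalMap

/-- The value of a formal series of maps at a point. -/
def eval (Φ : FormalMap 𝕜 A D) (x : Fin D → 𝕜) : FormalVec 𝕜 A D :=
  fun i m => Φ m x i

/-- The Jacobian matrix of a formal series of maps at a point, computed term by term. -/
def jacobian (Φ : FormalMap 𝕜 A D) (x : Fin D → 𝕜) :
    Matrix (Fin D) (Fin D) (MvPowerSeries A 𝕜) :=
  Matrix.of fun i j m => fderiv 𝕜 (Φ m) x (Pi.single j 1) i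

/-- A map, seen as a formal series with a constant term only. -/
def ofMap (F : (Fin D → 𝕜) → (Fin D → 𝕜)) : FormalMap 𝕜 A D :=
  open Classical in fun m => if m = 0 then F else 0

/-- The Lie-Jacobi bracket `[Φ, Ψ](x) = Ψ'(x) Φ(x) - Φ'(x) Ψ(x)` of formal vector fields. -/
def bracket (Φ Ψ : FormalMap 𝕜 A D) (x : Fin D → 𝕜) : FormalVec 𝕜 A D :=
  (Ψ.jacobian x).mulVec (Φ.eval x) - (Φ.jacobian x).mulVec (Ψ.eval x)

end FormalMap

/-- The word series `W_δ = ∑_w δ_w f_w`, as a formal series of maps. -/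
def wordSeries (f : A → (Fin D → 𝕜) → (Fin D → 𝕜)) (δ : List A → 𝕜) : FormalMap 𝕜 A D :=
  fun m x => ∑ w ∈ wordsOf m, δ w • wordBasis f w x

/-- Substitution of a vector `X` of power series in a smooth map `F`, through the Taylor expansion
`F(x + h) = ∑_k (1 / k!) F^{(k)}(x)(h, …, h)`, where `x` is the constant term of `X` and
`h = X - x`. Since `h` has no constant term, only the terms with `k` not larger than the degree of
the monomial `ε^m` contribute to its coefficient. -/
def substMap (F : (Fin D → 𝕜) → (Fin D → 𝕜)) (X : FormalVec 𝕜 A D) : FormalVec 𝕜 A D :=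
  fun i m =>
    ∑ k ∈ Finset.range (m.degree + 1), ((k.factorial : 𝕜))⁻¹ *
      ∑ j : Fin k → Fin D,
        iteratedFDeriv 𝕜 k F (fun i => MvPowerSeries.constantCoeff (X i))
            (fun r => Pi.single (j r) 1) i *
          MvPowerSeries.coeff m
            (∏ r, (X (j r) - MvPowerSeries.C (MvPowerSeries.constantCoeff (X (j r)))))

end Fields

end WordSeries

end

open WordSeries

/-! Let a letter `ℓ` act as the derivation along `f_ℓ` and a word `w` as the composite operator
`D_w` (`iterD`). Then `f_w = D_w id`, and a word series is the value at `id` of the operator series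
`∑ δ_w D_w`. By the Leibniz rule, `D_w` of a product is a sum over the pairs of complementary
subwords of `w`, and this deshuffle is dual to the shuffle product (`count_deshuffle`). Hence the
operator series of `γ ∈ 𝒢` is multiplicative and that of `β ∈ 𝔤` is a derivation. Only words of
length `|m|` contribute to the coefficient of `ε^m`, so a smooth `H` may be replaced by a Taylor
polynomial, and the action on monomials decides everything: `∑ γ_w D_w H = H(W_γ)`
(`substMap_wordSeries`) and `∑ β_w D_w H = H' W_β` (`sum_smul_iterD_of_mem_algebraG`). The
eigenvalue relation `[g^v, f_ℓ] = ν^v_ℓ f_ℓ` enters twice. Infinitesimally, moving the derivation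
along `g^v` past `D_w` costs `ν^v_w D_w`, so `W_δ' g^v = ∑ δ_w D_w g^v + W_{ξ_v δ}`
(`fderiv_wordSeries_gField`). At time one, `φ_v' f_ℓ = e^{-ν^v_ℓ} f_ℓ ∘ φ_v`, so `W_δ ∘ φ_v = ∑ (Ξ_v
δ)_w D_w φ_v` (`sum_XiOp_smul_iterD_timeOneFlow`). Taking `H = g^v` or `H = φ_v`, with coefficients
in `𝔤` or `𝒢`, gives the four identities. Smoothness of the flow comes from the inverse function
theorem for the integral equation in the space of continuous curves on `[0, 1]`. -/

noncomputable section

namespace WordSeries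

/-! ### Symmetry of higher derivatives and Taylor polynomials. -/

section Taylor

variable {𝕜 : Type*} [RCLike 𝕜] {E F : Type*} [NormedAddCommGroup E] [NormedSpace 𝕜 E]
  [NormedAddCommGroup F] [NormedSpace 𝕜 F]

theorem natCast_le_infty (n : ℕ) : (n : WithTop ℕ∞) ≤ ∞ := by
  exact_mod_cast le_top

theorem two_add_natCast_le_infty (n : ℕ) : (2 : WithTop ℕ∞) + n ≤ ∞ := by
  exact_mod_cast natCast_le_infty (2 + n)

theorem differentiableAt_of_contDiffOn {U : Set E} (hU : IsOpen U) {H : E → F}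
    (hH : ContDiffOn 𝕜 ∞ H U) {x : E} (hx : x ∈ U) : DifferentiableAt 𝕜 H x :=
  (hH.contDiffAt (hU.mem_nhds hx)).differentiableAt (by simp)

theorem differentiableAt_iteratedFDeriv_of_contDiffOn {U : Set E} (hU : IsOpen U) {H : E → F}
    (hH : ContDiffOn 𝕜 ∞ H U) (n : ℕ) {x : E} (hx : x ∈ U) :
    DifferentiableAt 𝕜 (iteratedFDeriv 𝕜 n H) x :=
  ((hH.contDiffAt (hU.mem_nhds hx)).iteratedFDeriv_right (m := 1) (i := n)
    (by exact_mod_cast le_top)).differentiableAt (by simp)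

/-- The iterated derivatives of a smooth map are symmetric. -/
theorem iteratedFDeriv_comp_perm_of_contDiffOn {U : Set E} (hU : IsOpen U) {H : E → F}
    (hH : ContDiffOn 𝕜 ∞ H U) (n : ℕ) : ∀ x ∈ U, ∀ (v : Fin n → E) (σ : Equiv.Perm (Fin n)),
      iteratedFDeriv 𝕜 n H x (v ∘ σ) = iteratedFDeriv 𝕜 n H x v := by
  induction n with
  | zero =>
    intro x _ v σ
    congr 1
    exact Subsingleton.elim _ _
  | succ n ih =>
    intro x hx v σ
    -- Adjacent transpositions generate the symmetric group. The swap of the first two slots is the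
    -- symmetry of the second derivative of `iteratedFDeriv 𝕜 n H`; any other one fixes slot `0`, so
    -- it follows by differentiating the induction hypothesis, which holds at all points near `x`.
    have key : ∀ σ ∈ Submonoid.closure
        (Set.range fun i : Fin n => Equiv.swap i.castSucc i.succ), ∀ v : Fin (n + 1) → E,
        iteratedFDeriv 𝕜 (n + 1) H x (v ∘ σ) = iteratedFDeriv 𝕜 (n + 1) H x v := by
      intro σ hσ
      induction hσ using Submonoid.closure_induction with
      | one => intro v; rfl
      | mul a b _ _ ha hb =>
        intro v
        rw [Equiv.Perm.coe_mul, ← Function.comp_assoc, hb, ha]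
      | mem a ha =>
        obtain ⟨i, rfl⟩ := ha
        intro v
        cases n with
        | zero => exact i.elim0
        | succ n =>
          induction i using Fin.cases with
          | zero =>
            have hs : IsSymmSndFDerivAt 𝕜 (iteratedFDeriv 𝕜 n H) x :=
              ((hH.contDiffAt (hU.mem_nhds hx)).iteratedFDeriv_right (m := 2) (i := n)
                (two_add_natCast_le_infty n)).isSymmSndFDerivAt (by simp)
            have hcongr : ∀ w : Fin (n + 2) → E, iteratedFDeriv 𝕜 (n + 2) H x w =
                fderiv 𝕜 (fderiv 𝕜 (iteratedFDeriv 𝕜 n H)) x (w 0) (w 1)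
                  (Fin.tail (Fin.tail w)) := by
              intro w
              have hdd : DifferentiableAt 𝕜 (fderiv 𝕜 (iteratedFDeriv 𝕜 n H)) x :=
                (((hH.contDiffAt (hU.mem_nhds hx)).iteratedFDeriv_right (m := 2) (i := n)
                  (two_add_natCast_le_infty n)).fderiv_right (m := 1) (by norm_num)).differentiableAt
                    (by simp)
              rw [(differentiableAt_iteratedFDeriv_of_contDiffOn hU hH (n + 1)
                hx).iteratedFDeriv_succ_apply_left']
              have : (fun y => iteratedFDeriv 𝕜 (n + 1) H y (Fin.tail w)) =
                  fun y => fderiv 𝕜 (iteratedFDeriv 𝕜 n H) y (w 1) (Fin.tail (Fin.tail w)) := by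
                funext y
                rw [iteratedFDeriv_succ_apply_left]
                rfl
              rw [this]
              have h2 := hdd.hasFDerivAt.clm_apply (hasFDerivAt_const (w 1) x)
              have h3 := (ContinuousMultilinearMap.apply 𝕜 (fun _ : Fin n => E) F
                (Fin.tail (Fin.tail w))).hasFDerivAt.comp x h2
              rw [HasFDerivAt.fderiv (f := fun y => fderiv 𝕜 (iteratedFDeriv 𝕜 n H) y (w 1)
                (Fin.tail (Fin.tail w))) h3]
              simp
            rw [hcongr, hcongr, hs.eq]
            have e0 : (v ∘ Equiv.swap (Fin.castSucc (0 : Fin (n + 1))) (Fin.succ 0)) 0 = v 1 := by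
              simp
            have e1 : (v ∘ Equiv.swap (Fin.castSucc (0 : Fin (n + 1))) (Fin.succ 0)) 1 = v 0 := by
              simp
            have e2 : Fin.tail (Fin.tail
                (v ∘ Equiv.swap (Fin.castSucc (0 : Fin (n + 1))) (Fin.succ 0))) =
                Fin.tail (Fin.tail v) := by
              funext j
              simp only [Fin.tail, Function.comp_apply]
              rw [Equiv.swap_apply_of_ne_of_ne]
              · simp [Fin.ext_iff]
              · simp [Fin.ext_iff]
            rw [e0, e1, e2]
          | succ j =>
            have hd := differentiableAt_iteratedFDeriv_of_contDiffOn hU hH (n + 1) hx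
            rw [hd.iteratedFDeriv_succ_apply_left', hd.iteratedFDeriv_succ_apply_left']
            have e0 : (v ∘ Equiv.swap (Fin.castSucc j.succ) (Fin.succ j.succ)) 0 = v 0 := by
              simp only [Function.comp_apply]
              rw [Equiv.swap_apply_of_ne_of_ne]
              · simp [Fin.ext_iff]
              · simp [Fin.ext_iff]
            have e1 : Fin.tail (v ∘ Equiv.swap (Fin.castSucc j.succ) (Fin.succ j.succ)) =
                Fin.tail v ∘ Equiv.swap j.castSucc j.succ := by
              funext r
              simp only [Fin.tail, Function.comp_apply]
              congr 1
              rw [← Fin.succ_castSucc, (Fin.succ_injective _).swap_apply]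
            rw [e0, e1]
            congr 1
            apply Filter.EventuallyEq.fderiv_eq
            filter_upwards [hU.mem_nhds hx] with y hy using ih y hy _ _
    have hmem : σ ∈ Submonoid.closure
        (Set.range fun i : Fin n => Equiv.swap i.castSucc i.succ) := by
      rw [Equiv.Perm.mclosure_swap_castSucc_succ]
      trivial
    exact key σ hmem v

/-- The Taylor polynomial of degree `N` of `H` at `x`. -/
def taylorSum (𝕜 : Type*) [RCLike 𝕜] [NormedSpace 𝕜 E] [NormedSpace 𝕜 F] (H : E → F) (x : E)
    (N : ℕ) (y : E) : F :=
  ∑ k ∈ Finset.range (N + 1), (k.factorial : 𝕜)⁻¹ • iteratedFDeriv 𝕜 k H x fun _ => y - x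

theorem contDiff_taylorSum (H : E → F) (x : E) (N : ℕ) : ContDiff 𝕜 ∞ (taylorSum 𝕜 H x N) := by
  unfold taylorSum
  refine ContDiff.sum fun k _ => contDiff_const.smul ?_
  exact (iteratedFDeriv 𝕜 k H x).contDiff.comp
    (contDiff_pi.2 fun _ => contDiff_id.sub contDiff_const)

/-- The derivatives up to order `N` of the Taylor polynomial of degree `N`. -/
theorem iteratedFDeriv_taylorSum {U : Set E} (hU : IsOpen U) {H : E → F}
    (hH : ContDiffOn 𝕜 ∞ H U) {x : E} (hx : x ∈ U) {k N : ℕ} (hk : k ≤ N) :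
    iteratedFDeriv 𝕜 k (taylorSum 𝕜 H x N) x = iteratedFDeriv 𝕜 k H x := by
  let p : FormalMultilinearSeries 𝕜 E F := fun k =>
    if k < N + 1 then (k.factorial : 𝕜)⁻¹ • iteratedFDeriv 𝕜 k H x else 0
  have hp : ∀ m, N + 1 ≤ m → p m = 0 := fun m hm => if_neg (by omega)
  have hball := p.hasFiniteFPowerSeriesOnBall_of_finite hp
  have hsum : HasFiniteFPowerSeriesOnBall (taylorSum 𝕜 H x N) p x (N + 1) ⊤ := by
    have := hball.comp_sub x
    rw [zero_add] at this
    refine this.congr fun y _ => ?_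
    change p.sum (y - x) = _
    rw [FormalMultilinearSeries.sum_of_finite p hp, FormalMultilinearSeries.partialSum]
    refine Finset.sum_congr rfl fun m hm => ?_
    simp [p, Nat.lt_succ_iff.1 (Finset.mem_range.1 hm)]
  ext v
  rw [hsum.toHasFPowerSeriesOnBall.iteratedFDeriv_eq_sum]
  -- The derivative of a power series is the sum of its `k`-th term over all permutations of the
  -- arguments; by symmetry the `k!` summands agree, which cancels the factor `1 / k!`.
  · have : ∀ σ : Equiv.Perm (Fin k), p k (fun i => v (σ i)) =
        (k.factorial : 𝕜)⁻¹ • iteratedFDeriv 𝕜 k H x v := by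
      intro σ
      rw [← iteratedFDeriv_comp_perm_of_contDiffOn hU hH k x hx v σ]
      simp only [p, if_pos (Nat.lt_succ_of_le hk)]
      rfl
    simp only [this, Finset.sum_const, Finset.card_univ, Fintype.card_perm, Fintype.card_fin]
    rw [← Nat.cast_smul_eq_nsmul 𝕜, smul_smul, mul_inv_cancel₀, one_smul]
    exact_mod_cast k.factorial_ne_zero
  · have hon := hsum.cpolynomialOn
    rw [Metric.eball_top] at hon
    exact hon.analyticOn

end Taylor

/-! ### Superposition operators on spaces of continuous functions. -/

section Nemytskii

universe u

variable {𝕜 : Type*} [RCLike 𝕜] {α : Type*} [TopologicalSpace α] [CompactSpace α]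

section

variable {E F : Type*} [NormedAddCommGroup E] [NormedSpace 𝕜 E] [NormedAddCommGroup F]
  [NormedSpace 𝕜 F]

variable (𝕜 α E F) in
/-- Pointwise application of a continuous family of linear maps. -/
def pointwiseApply : C(α, E →L[𝕜] F) →L[𝕜] C(α, E) →L[𝕜] C(α, F) :=
  LinearMap.mkContinuous₂
    (LinearMap.mk₂ 𝕜 (fun (a : C(α, E →L[𝕜] F)) (c : C(α, E)) => (⟨fun t => a t (c t), by fun_prop⟩ : C(α, F)))
      (fun _ _ _ => by ext; simp) (fun _ _ _ => by ext; simp) (fun _ _ _ => by ext; simp)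
      (fun _ _ _ => by ext; simp)) 1 fun a c => by
    rw [one_mul]
    refine (ContinuousMap.norm_le _ (by positivity)).2 fun t => ?_
    exact (a t).le_of_opNorm_le_of_le (a.norm_coe_le_norm t) (c.norm_coe_le_norm t)

@[simp]
theorem pointwiseApply_apply (a : C(α, E →L[𝕜] F)) (c : C(α, E)) (t : α) :
    pointwiseApply 𝕜 α E F a c t = a t (c t) := rfl

/-- The derivative of the superposition operator `c ↦ G ∘ c` on continuous functions. -/
theorem hasFDerivAt_comp_continuousMap {G : C(E, F)} {G' : C(E, E →L[𝕜] F)}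
    (hG : ∀ x, HasFDerivAt G (G' x) x) (c : C(α, E)) :
    HasFDerivAt (fun c : C(α, E) => G.comp c) (pointwiseApply 𝕜 α E F (G'.comp c)) c := by
  let _ : NormedSpace ℝ E := NormedSpace.restrictScalars ℝ 𝕜 E
  rw [hasFDerivAt_iff_isLittleO_nhds_zero, Asymptotics.isLittleO_iff]
  intro ε hε
  -- Continuity of `G'` is uniform near the compact range of `c`, so one `δ` serves for all `t`.
  have hunif := (isCompact_range c.continuous).uniformContinuousAt_of_continuousAt G'
    (fun a _ => G'.continuous.continuousAt) (Metric.dist_mem_uniformity hε)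
  obtain ⟨δ, hδ, hδ'⟩ := Metric.mem_uniformity_dist.1 hunif
  filter_upwards [Metric.ball_mem_nhds (0 : C(α, E)) hδ] with h hh
  rw [mem_ball_zero_iff] at hh
  refine (ContinuousMap.norm_le _ (by positivity)).2 fun t => ?_
  have hbound : ∀ y ∈ Metric.ball (c t) δ, ‖fderiv 𝕜 G y - G' (c t)‖ ≤ ε := by
    intro y hy
    rw [(hG y).fderiv, ← dist_eq_norm, dist_comm]
    have : dist (c t) y < δ := by rwa [dist_comm]
    exact (hδ' this ⟨t, rfl⟩).le
  have hmem : c t + h t ∈ Metric.ball (c t) δ := by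
    simpa using (h.norm_coe_le_norm t).trans_lt hh
  have := (convex_ball (c t) δ).norm_image_sub_le_of_norm_fderiv_le' (𝕜 := 𝕜)
    (fun y _ => (hG y).differentiableAt) hbound (Metric.mem_ball_self hδ) hmem
  rw [add_sub_cancel_left] at this
  exact this.trans (mul_le_mul_of_nonneg_left (h.norm_coe_le_norm t) hε.le)

end

variable {E : Type u} [NormedAddCommGroup E] [NormedSpace 𝕜 E]

/-- The superposition operator of a smooth map is smooth. -/
theorem contDiff_comp_continuousMap {F : Type u} [NormedAddCommGroup F] [NormedSpace 𝕜 F]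
    {G : C(E, F)} (hG : ContDiff 𝕜 ∞ G) : ContDiff 𝕜 ∞ (fun c : C(α, E) => G.comp c) := by
  rw [contDiff_infty]
  intro n
  -- The target varies because the derivative is the superposition operator of `fderiv 𝕜 G`, with
  -- values in `E →L[𝕜] F`; a common universe for `E` and `F` keeps this space in the same universe.
  induction n generalizing F with
  | zero => exact contDiff_zero.2 (ContinuousMap.continuous_postcomp G)
  | succ n ih =>
    have hG' : ContDiff 𝕜 ∞ (fderiv 𝕜 G) := hG.fderiv_right (by simp)
    let G' : C(E, E →L[𝕜] F) := ⟨fderiv 𝕜 G, hG'.continuous⟩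
    refine contDiff_succ_iff_hasFDerivAt.2
      ⟨fun c => pointwiseApply 𝕜 α E F (G'.comp c), ?_, fun c => ?_⟩
    · exact (pointwiseApply 𝕜 α E F).contDiff.comp (ih (G := G') hG')
    · exact hasFDerivAt_comp_continuousMap
        (fun x => (hG.differentiable (by simp) x).hasFDerivAt) c

end Nemytskii

/-! ### Volterra equations and the integral form of an initial value problem. -/

section Volterra

open intervalIntegral MeasureTheory

variable {𝕜 : Type*} [RCLike 𝕜] {E : Type*} [NormedAddCommGroup E] [NormedSpace 𝕜 E]
  [NormedSpace ℝ E] [IsScalarTower ℝ 𝕜 E]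

theorem continuous_IccExtend {E : Type*} [TopologicalSpace E] (c : C(unitInterval, E)) :
    Continuous (Set.IccExtend (zero_le_one' ℝ) c) :=
  c.continuous.Icc_extend'

variable (𝕜 E) in
/-- The integral operator `c ↦ ∫ s in 0..t, c s` on the continuous functions on `[0, 1]`. -/
def volterra : C(unitInterval, E) →L[𝕜] C(unitInterval, E) :=
  LinearMap.mkContinuous
    { toFun := fun c => ⟨fun t => ∫ s in (0 : ℝ)..t, Set.IccExtend (zero_le_one' ℝ) c s,
        (intervalIntegral.continuous_primitive
          (fun _ _ => (continuous_IccExtend c).intervalIntegrable _ _) 0).comp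
            continuous_subtype_val⟩
      map_add' := fun a b => by
        ext t
        exact intervalIntegral.integral_add ((continuous_IccExtend a).intervalIntegrable _ _)
          ((continuous_IccExtend b).intervalIntegrable _ _)
      map_smul' := fun r a => by
        ext t
        exact intervalIntegral.integral_smul r (Set.IccExtend (zero_le_one' ℝ) a) }
    1 fun c => by
      rw [one_mul]
      refine (ContinuousMap.norm_le _ (norm_nonneg _)).2 fun t => ?_
      have := intervalIntegral.norm_integral_le_of_norm_le_const (a := 0) (b := (t : ℝ))
        (f := Set.IccExtend (zero_le_one' ℝ) c) (C := ‖c‖) fun s _ => c.norm_coe_le_norm _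
      refine this.trans ?_
      rw [sub_zero, abs_of_nonneg t.2.1]
      exact mul_le_of_le_one_right (norm_nonneg _) t.2.2

theorem volterra_apply (c : C(unitInterval, E)) (t : unitInterval) :
    volterra 𝕜 E c t = ∫ s in (0 : ℝ)..t, Set.IccExtend (zero_le_one' ℝ) c s := rfl

/-- The `n` nested integrals run over a simplex of volume `t ^ n / n!`. The bound is pointwise in
`t` because the induction integrates `s ^ n`. -/
theorem norm_volterra_pow_apply_le (a : C(unitInterval, E →L[𝕜] E)) (n : ℕ)
    (c : C(unitInterval, E)) (t : unitInterval) :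
    ‖((volterra 𝕜 E ∘L pointwiseApply 𝕜 unitInterval E E a) ^ n) c t‖ ≤
      ‖a‖ ^ n * (t : ℝ) ^ n / n.factorial * ‖c‖ := by
  induction n generalizing t with
  | zero => simpa using c.norm_coe_le_norm t
  | succ n ih =>
    rw [pow_succ', mul_apply_eq_comp, ContinuousLinearMap.comp_apply, volterra_apply]
    have hle : ∀ s ∈ Set.Ioc (0 : ℝ) t, ‖Set.IccExtend (zero_le_one' ℝ)
        (pointwiseApply 𝕜 unitInterval E E a
          (((volterra 𝕜 E ∘L pointwiseApply 𝕜 unitInterval E E a) ^ n) c)) s‖ ≤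
        ‖a‖ ^ (n + 1) / n.factorial * ‖c‖ * s ^ n := by
      intro s hs
      have hs' : s ∈ Set.Icc (0 : ℝ) 1 := ⟨hs.1.le, hs.2.trans t.2.2⟩
      rw [Set.IccExtend_of_mem _ _ hs', pointwiseApply_apply]
      refine ((a ⟨s, hs'⟩).le_of_opNorm_le_of_le (a.norm_coe_le_norm _) (ih ⟨s, hs'⟩)).trans
        (le_of_eq ?_)
      simp only
      ring
    refine (intervalIntegral.norm_integral_le_of_norm_le t.2.1
      (Filter.Eventually.of_forall hle) ?_).trans (le_of_eq ?_)
    · exact (by fun_prop : Continuous fun s : ℝ =>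
        ‖a‖ ^ (n + 1) / n.factorial * ‖c‖ * s ^ n).intervalIntegrable _ _
    · rw [intervalIntegral.integral_const_mul, integral_pow, Nat.factorial_succ]
      push_cast
      field_simp
      simp

/-- Linear Volterra equations on `[0, 1]` are uniquely solvable. -/
theorem isUnit_one_sub_volterra [CompleteSpace E] (a : C(unitInterval, E →L[𝕜] E)) :
    IsUnit (1 - volterra 𝕜 E ∘L pointwiseApply 𝕜 unitInterval E E a) := by
  set T := volterra 𝕜 E ∘L pointwiseApply 𝕜 unitInterval E E a
  -- `T` itself may be large, but some power has norm below one. Then `1 - T ^ n` is invertible, and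
  -- so is its factor `1 - T`, since it commutes with the cofactor `∑ T ^ i`.
  obtain ⟨n, hn⟩ := ((FloorSemiring.tendsto_pow_div_factorial_atTop ‖a‖).eventually_lt_const
    (one_pos)).exists
  have hT : ‖T ^ n‖ ≤ ‖a‖ ^ n / n.factorial := by
    refine ContinuousLinearMap.opNorm_le_bound _ (by positivity) fun c => ?_
    refine (ContinuousMap.norm_le _ (by positivity)).2 fun t => ?_
    refine (norm_volterra_pow_apply_le a n c t).trans ?_
    gcongr
    exact mul_le_of_le_one_right (by positivity) (pow_le_one₀ t.2.1 t.2.2)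
  have hunit : IsUnit (1 - T ^ n) :=
    isUnit_one_sub_of_norm_lt_one (R := C(unitInterval, E) →L[𝕜] C(unitInterval, E)) (hT.trans_lt hn)
  have hcomm : Commute (1 - T) (∑ i ∈ Finset.range n, T ^ i) := by
    rw [Commute, SemiconjBy, mul_neg_geom_sum, geom_sum_mul_neg]
  rw [← mul_neg_geom_sum] at hunit
  exact (hcomm.isUnit_mul_iff.1 hunit).1

/-- The curve defined by a continuous function `c` on `[0, 1]` with `c - ∫ G ∘ c` constant is an
integral curve of `G`. -/
theorem isIntegralCurveOn_of_volterra [CompleteSpace E] {G : C(E, E)} {c : C(unitInterval, E)}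
    {x : E} (hc : c - volterra 𝕜 E (G.comp c) = ContinuousMap.const _ x) :
    Set.IccExtend (zero_le_one' ℝ) c 0 = x ∧
      IsIntegralCurveOn (Set.IccExtend (zero_le_one' ℝ) c) (fun _ => G) (Set.Icc 0 1) := by
  have hval : ∀ t : unitInterval, c t = x + ∫ s in (0 : ℝ)..t,
      Set.IccExtend (zero_le_one' ℝ) (G.comp c) s := by
    intro t
    have := DFunLike.congr_fun hc t
    rw [ContinuousMap.sub_apply, volterra_apply, ContinuousMap.const_apply] at this
    rw [← this, sub_add_cancel]
  refine ⟨?_, fun t ht => ?_⟩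
  · rw [Set.IccExtend_left, hval]
    simp
  · have hd : HasDerivAt (fun u : ℝ => x + ∫ s in (0 : ℝ)..u,
        Set.IccExtend (zero_le_one' ℝ) (G.comp c) s)
        (Set.IccExtend (zero_le_one' ℝ) (G.comp c) t) t :=
      (intervalIntegral.integral_hasDerivAt_right
        ((continuous_IccExtend (G.comp c)).intervalIntegrable _ _)
        ((continuous_IccExtend (G.comp c)).stronglyMeasurableAtFilter _ _)
        (continuous_IccExtend (G.comp c)).continuousAt).const_add x
    rw [Set.IccExtend_of_mem _ _ ht] at hd ⊢
    refine hd.hasDerivWithinAt.congr (fun u hu => ?_) ?_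
    · rw [Set.IccExtend_of_mem _ _ hu, hval]
    · rw [Set.IccExtend_of_mem _ _ ht, hval]

/-- A function with a continuous derivative on `[0, 1]` is the integral of its derivative. -/
theorem sub_volterra_eq_const [CompleteSpace E] {c c' : C(unitInterval, E)}
    (hc : ∀ t : unitInterval, HasDerivWithinAt (Set.IccExtend (zero_le_one' ℝ) c) (c' t)
      (Set.Icc 0 1) t) : c - volterra 𝕜 E c' = ContinuousMap.const _ (c 0) := by
  ext t
  rw [ContinuousMap.sub_apply, volterra_apply, ContinuousMap.const_apply,
    intervalIntegral.integral_eq_sub_of_hasDeriv_right_of_le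
      (f := Set.IccExtend (zero_le_one' ℝ) c) t.2.1
      (continuous_IccExtend c).continuousOn (fun s hs => ?_)
      ((continuous_IccExtend c').intervalIntegrable _ _)]
  · rw [Set.IccExtend_left, Set.IccExtend_val]
    simp
  · have hs' : s ∈ Set.Ioo (0 : ℝ) 1 := ⟨hs.1, hs.2.trans_le t.2.2⟩
    have hs'' := Set.Ioo_subset_Icc_self hs'
    rw [Set.IccExtend_of_mem _ _ hs'']
    exact ((hc ⟨s, hs''⟩).hasDerivAt (Icc_mem_nhds hs'.1 hs'.2)).hasDerivWithinAt

end Volterra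

/-! ### Smooth dependence of solutions on the initial value. -/

section Flow

open Filter Topology

universe u

variable {𝕜 : Type*} [RCLike 𝕜] {E : Type u} [NormedAddCommGroup E] [NormedSpace 𝕜 E]
  [NormedSpace ℝ E] [IsScalarTower ℝ 𝕜 E] [CompleteSpace E]

/-- The solution of an initial value problem on `[0, 1]` is, as a continuous function, a smooth
function of the initial value; its derivative solves the variational equation. -/
theorem exists_contDiffAt_solution {G : C(E, E)} (hG : ContDiff 𝕜 ∞ G) {c₀ : C(unitInterval, E)}
    {x₀ : E} (hc₀ : c₀ - volterra 𝕜 E (G.comp c₀) = ContinuousMap.const _ x₀) :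
    ∃ Φ : E → C(unitInterval, E), ContDiffAt 𝕜 ∞ Φ x₀ ∧ Φ x₀ = c₀ ∧
      (∀ᶠ x in 𝓝 x₀, Φ x - volterra 𝕜 E (G.comp (Φ x)) = ContinuousMap.const _ x) ∧
      ∀ h, fderiv 𝕜 Φ x₀ h - volterra 𝕜 E (pointwiseApply 𝕜 unitInterval E E
        ((⟨fderiv 𝕜 G, (hG.continuous_fderiv (by simp))⟩ : C(E, E →L[𝕜] E)).comp c₀)
          (fderiv 𝕜 Φ x₀ h)) = ContinuousMap.const _ h := by
  set G' : C(E, E →L[𝕜] E) := ⟨fderiv 𝕜 G, (hG.continuous_fderiv (by simp))⟩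
  -- A curve solves the problem with initial value `x` when `P c` is the constant `x`. The
  -- derivative of `P` is an invertible Volterra operator, so a local inverse of `P`, restricted to
  -- constants, is the solution map.
  let P : C(unitInterval, E) → C(unitInterval, E) := fun c => c - volterra 𝕜 E (G.comp c)
  have hP : ContDiff 𝕜 ∞ P :=
    contDiff_id.sub ((volterra 𝕜 E).contDiff.comp (contDiff_comp_continuousMap hG))
  obtain ⟨u, hu⟩ := isUnit_one_sub_volterra (𝕜 := 𝕜) (G'.comp c₀)
  have hP' : HasFDerivAt P (ContinuousLinearEquiv.ofUnit u :
      C(unitInterval, E) →L[𝕜] C(unitInterval, E)) c₀ := by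
    have h1 : HasFDerivAt P (ContinuousLinearMap.id 𝕜 _ -
        volterra 𝕜 E ∘L pointwiseApply 𝕜 unitInterval E E (G'.comp c₀)) c₀ :=
      (hasFDerivAt_id c₀).sub ((volterra 𝕜 E).hasFDerivAt.comp c₀
        (hasFDerivAt_comp_continuousMap (G' := G')
          (fun x => (hG.differentiable (by simp) x).hasFDerivAt) c₀))
    convert h1 using 1
    exact hu
  have hn : (∞ : WithTop ℕ∞) ≠ 0 := by simp
  let Ψ := hP.contDiffAt.localInverse hP' hn
  have hPc : P c₀ = ContinuousMap.const _ x₀ := hc₀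
  have hΨ : ContDiffAt 𝕜 ∞ Ψ (ContinuousMap.const _ x₀) := by
    rw [← hPc]
    exact hP.contDiffAt.to_localInverse hP' hn
  have hΨ₀ : Ψ (ContinuousMap.const _ x₀) = c₀ := by
    rw [← hPc]
    exact hP.contDiffAt.localInverse_apply_image hP' hn
  have hev : ∀ᶠ y in 𝓝 (ContinuousMap.const _ x₀), P (Ψ y) = y := by
    rw [← hPc]
    exact (hP.contDiffAt.hasStrictFDerivAt' hP' hn).eventually_right_inverse
  let K : E →L[𝕜] C(unitInterval, E) := ContinuousLinearMap.const 𝕜 unitInterval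
  have hK : ∀ x, K x = ContinuousMap.const _ x := fun _ => rfl
  have hΦ : ContDiffAt 𝕜 ∞ (Ψ ∘ K) x₀ := ContDiffAt.comp x₀ hΨ K.contDiff.contDiffAt
  have hevΦ : ∀ᶠ x in 𝓝 x₀, P ((Ψ ∘ K) x) = K x := K.continuous.continuousAt.eventually hev
  refine ⟨Ψ ∘ K, hΦ, hΨ₀, hevΦ, fun h => ?_⟩
  -- Differentiating `P ∘ Ψ ∘ K = K` gives the variational equation in integral form.
  have h1 : HasFDerivAt (fun x => P ((Ψ ∘ K) x)) K x₀ :=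
    K.hasFDerivAt.congr_of_eventuallyEq hevΦ
  have h2 : HasFDerivAt P (ContinuousLinearEquiv.ofUnit u :
      C(unitInterval, E) →L[𝕜] C(unitInterval, E)) ((Ψ ∘ K) x₀) := by
    rwa [show (Ψ ∘ K) x₀ = c₀ from hΨ₀]
  have h3 := h2.comp x₀ (hΦ.differentiableAt hn).hasFDerivAt
  have h4 := DFunLike.congr_fun (h3.unique h1) h
  rw [← hK, ← h4]
  have : ∀ y, (1 - volterra 𝕜 E ∘L pointwiseApply 𝕜 unitInterval E E (G'.comp c₀)) y =
    (u : C(unitInterval, E) →L[𝕜] C(unitInterval, E)) y := fun y => by rw [hu]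
  exact this _

end Flow

/-! ### The time-one flow: domain, smoothness, inverse and transport of eigenfields. -/

section TimeOneFlow

open Filter Topology

variable {𝕜 : Type*} [RCLike 𝕜] {D : ℕ} {G : (Fin D → 𝕜) → (Fin D → 𝕜)}

/-- Near a point of its domain, the flow is the end point of a smooth family of solutions. -/
theorem exists_contDiffAt_solution_of_mem_flowDomain (hG : ContDiff 𝕜 ∞ G) {x₀ : Fin D → 𝕜}
    (hx₀ : x₀ ∈ flowDomain G) :
    ∃ Φ : (Fin D → 𝕜) → C(unitInterval, Fin D → 𝕜), ContDiffAt 𝕜 ∞ Φ x₀ ∧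
      (∀ᶠ x in 𝓝 x₀, Φ x 0 = x ∧
        IsIntegralCurveOn (Set.IccExtend (zero_le_one' ℝ) (Φ x)) (fun _ => G) (Set.Icc 0 1) ∧
        timeOneFlow G x = Φ x 1) ∧
      ∀ h, fderiv 𝕜 Φ x₀ h - volterra 𝕜 _ (pointwiseApply 𝕜 unitInterval _ _
        ((⟨fderiv 𝕜 G, (hG.continuous_fderiv (by simp))⟩ :
          C((Fin D → 𝕜), (Fin D → 𝕜) →L[𝕜] (Fin D → 𝕜))).comp (Φ x₀))
          (fderiv 𝕜 Φ x₀ h)) = ContinuousMap.const _ h := by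
  obtain ⟨c, rfl, hc⟩ := hx₀
  let c₀ : C(unitInterval, Fin D → 𝕜) :=
    ⟨fun t => c t, continuousOn_iff_continuous_domRestrict.1 hc.continuousOn⟩
  let GC : C((Fin D → 𝕜), (Fin D → 𝕜)) := ⟨G, hG.continuous⟩
  have hext : Set.EqOn (Set.IccExtend (zero_le_one' ℝ) c₀) c (Set.Icc 0 1) := fun t ht => by
    rw [Set.IccExtend_of_mem _ _ ht]
    rfl
  have h0 : c₀ - volterra 𝕜 _ (GC.comp c₀) = ContinuousMap.const _ (c 0) :=
    sub_volterra_eq_const fun t => (hc t t.2).congr hext (hext t.2)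
  obtain ⟨Φ, h1, h2, h3, h4⟩ := exists_contDiffAt_solution (G := GC) hG h0
  refine ⟨Φ, h1, ?_, by rw [h2]; exact h4⟩
  filter_upwards [h3] with x hx
  obtain ⟨hx0, hx1⟩ := isIntegralCurveOn_of_volterra hx
  have := timeOneFlow_eq (hG.of_le (by simp)) hx1
  rw [hx0] at this
  rw [Set.IccExtend_left] at hx0
  exact ⟨hx0, hx1, by rw [this, Set.IccExtend_right]; rfl⟩

theorem isOpen_flowDomain (hG : ContDiff 𝕜 ∞ G) : IsOpen (flowDomain G) := by
  rw [isOpen_iff_mem_nhds]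
  intro x hx
  obtain ⟨Φ, -, h, -⟩ := exists_contDiffAt_solution_of_mem_flowDomain hG hx
  filter_upwards [h] with y hy
  exact ⟨_, by rw [Set.IccExtend_left]; exact hy.1, hy.2.1⟩

theorem hasFDerivAt_timeOneFlow_of_contDiffAt {x : Fin D → 𝕜}
    {Φ : (Fin D → 𝕜) → C(unitInterval, Fin D → 𝕜)} (hΦ : ContDiffAt 𝕜 ∞ Φ x)
    (h : ∀ᶠ y in 𝓝 x, timeOneFlow G y = Φ y 1) :
    ContDiffAt 𝕜 ∞ (timeOneFlow G) x ∧
      ∀ v, fderiv 𝕜 (timeOneFlow G) x v = fderiv 𝕜 Φ x v 1 := by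
  let ev : C(unitInterval, Fin D → 𝕜) →L[𝕜] (Fin D → 𝕜) := ContinuousMap.evalCLM 𝕜 1
  refine ⟨(ev.contDiff.contDiffAt.comp x hΦ).congr_of_eventuallyEq h, fun v => ?_⟩
  have := (ev.hasFDerivAt.comp x (hΦ.differentiableAt (by simp)).hasFDerivAt).congr_of_eventuallyEq
    (f₁ := timeOneFlow G) h
  rw [this.fderiv]
  rfl

theorem contDiffAt_timeOneFlow (hG : ContDiff 𝕜 ∞ G) {x : Fin D → 𝕜} (hx : x ∈ flowDomain G) :
    ContDiffAt 𝕜 ∞ (timeOneFlow G) x := by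
  obtain ⟨Φ, h1, h2, -⟩ := exists_contDiffAt_solution_of_mem_flowDomain hG hx
  exact (hasFDerivAt_timeOneFlow_of_contDiffAt h1 (h2.mono fun y hy => hy.2.2)).1

/-- The flow of `-G` inverts the flow of `G`. -/
theorem timeOneFlow_neg_timeOneFlow (hG : ContDiff 𝕜 ∞ G) {x : Fin D → 𝕜}
    (hx : x ∈ flowDomain G) :
    timeOneFlow G x ∈ flowDomain (-G) ∧ timeOneFlow (-G) (timeOneFlow G x) = x := by
  obtain ⟨c, rfl, hc⟩ := hx
  have hrev : IsIntegralCurveOn (fun t => c (1 - t)) (fun _ => -G) (Set.Icc 0 1) := by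
    intro t ht
    have hmaps : Set.MapsTo (fun t : ℝ => 1 - t) (Set.Icc 0 1) (Set.Icc 0 1) :=
      fun s hs => ⟨by linarith [hs.2], by linarith [hs.1]⟩
    have h1 : HasDerivWithinAt (fun t : ℝ => 1 - t) (-1) (Set.Icc 0 1) t := by
      simpa using (hasDerivWithinAt_id t _).const_sub 1
    have h2 := (hc (1 - t) (hmaps ht)).scomp t h1 hmaps
    simpa [Function.comp_def] using h2
  rw [timeOneFlow_eq (hG.of_le (by simp)) hc]
  refine ⟨⟨_, by simp, hrev⟩, ?_⟩
  have h3 := timeOneFlow_eq (G := -G) (hG.neg.of_le (by simp)) hrev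
  simpa using h3

/-- The derivative of the flow is injective. -/
theorem fderiv_timeOneFlow_injective (hG : ContDiff 𝕜 ∞ G) {x : Fin D → 𝕜}
    (hx : x ∈ flowDomain G) : Function.Injective (fderiv 𝕜 (timeOneFlow G) x) := by
  obtain ⟨hmem, -⟩ := timeOneFlow_neg_timeOneFlow hG hx
  have h1 := ((contDiffAt_timeOneFlow hG.neg hmem).differentiableAt (by simp)).hasFDerivAt.comp x
    ((contDiffAt_timeOneFlow hG hx).differentiableAt (by simp)).hasFDerivAt
  have h2 : timeOneFlow (-G) ∘ timeOneFlow G =ᶠ[𝓝 x] id := by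
    filter_upwards [(isOpen_flowDomain hG).mem_nhds hx] with y hy
    exact (timeOneFlow_neg_timeOneFlow hG hy).2
  have h3 := h1.unique ((hasFDerivAt_id x).congr_of_eventuallyEq h2)
  intro a b hab
  have ha := DFunLike.congr_fun h3 a
  have hb := DFunLike.congr_fun h3 b
  simp only [ContinuousLinearMap.comp_apply, ContinuousLinearMap.id_apply] at ha hb
  rw [← ha, ← hb, hab]

/-- If `[G, f] = μ f`, the flow of `G` at time one transports the field `f` to `exp (-μ) f`. -/
theorem fderiv_timeOneFlow_apply_of_lieBracket_eq_smul (hG : ContDiff 𝕜 ∞ G)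
    {f : (Fin D → 𝕜) → (Fin D → 𝕜)} (hf : ContDiff 𝕜 ∞ f) {μ : 𝕜}
    (hfG : VectorField.lieBracket 𝕜 G f = μ • f) {x : Fin D → 𝕜} (hx : x ∈ flowDomain G) :
    fderiv 𝕜 (timeOneFlow G) x (f x) = NormedSpace.exp (-μ) • f (timeOneFlow G x) := by
  obtain ⟨Φ, h1, h2, h3⟩ := exists_contDiffAt_solution_of_mem_flowDomain hG hx
  obtain ⟨-, h4⟩ := hasFDerivAt_timeOneFlow_of_contDiffAt h1 (h2.mono fun y hy => hy.2.2)
  obtain ⟨hx0, hx1, hx2⟩ := h2.self_of_nhds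
  set c := Φ x
  set G' : C((Fin D → 𝕜), (Fin D → 𝕜) →L[𝕜] (Fin D → 𝕜)) :=
    ⟨fderiv 𝕜 G, (hG.continuous_fderiv (by simp))⟩
  have hexp : ∀ t : ℝ, HasDerivAt (fun s : ℝ => NormedSpace.exp (-(s • μ)))
      (-μ * NormedSpace.exp (-(t • μ))) t := by
    intro t
    have := hasDerivAt_exp_smul_const (𝕂 := ℝ) (-μ) t
    simpa [smul_neg, mul_comm] using this
  -- Along the curve, `(f ∘ c)' = f'(c) G(c) = G'(c) f(c) + μ f(c)`. The exponential factor removes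
  -- the last term, so `Z` solves the variational equation with initial value `f x`.
  let Z : C(unitInterval, Fin D → 𝕜) := ⟨fun t => NormedSpace.exp (-((t : ℝ) • μ)) • f (c t), by
    have : Continuous fun s : ℝ => NormedSpace.exp (-(s • μ)) :=
      continuous_iff_continuousAt.2 fun t => (hexp t).continuousAt
    exact (this.comp continuous_subtype_val).smul (hf.continuous.comp c.continuous)⟩
  have hZ : Z - volterra 𝕜 _ (pointwiseApply 𝕜 unitInterval _ _ (G'.comp c) Z) =
      ContinuousMap.const _ (Z 0) := by
    refine sub_volterra_eq_const fun t => ?_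
    have hc := hx1 t t.2
    rw [Set.IccExtend_val] at hc
    have hfc : HasDerivWithinAt (fun s => f (Set.IccExtend (zero_le_one' ℝ) c s))
        (fderiv 𝕜 f (c t) (G (c t))) (Set.Icc 0 1) t := by
      have hff : HasFDerivAt f ((fderiv 𝕜 f (c t)).restrictScalars ℝ)
          (Set.IccExtend (zero_le_one' ℝ) c t) := by
        rw [Set.IccExtend_val]
        exact (hf.differentiable (by simp) (c t)).hasFDerivAt.restrictScalars ℝ
      exact hff.comp_hasDerivWithinAt (t : ℝ) hc
    have hprod := (hexp t).hasDerivWithinAt.smul hfc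
    have hder : NormedSpace.exp (-((t : ℝ) • μ)) • fderiv 𝕜 f (c t) (G (c t)) +
        (-μ * NormedSpace.exp (-((t : ℝ) • μ))) • f (Set.IccExtend (zero_le_one' ℝ) c t) =
        pointwiseApply 𝕜 unitInterval _ _ (G'.comp c) Z t := by
      have hb : fderiv 𝕜 f (c t) (G (c t)) - fderiv 𝕜 G (c t) (f (c t)) = μ • f (c t) :=
        congrFun hfG (c t)
      rw [sub_eq_iff_eq_add] at hb
      rw [Set.IccExtend_val, hb]
      change _ = fderiv 𝕜 G (c t) (NormedSpace.exp (-((t : ℝ) • μ)) • f (c t))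
      rw [map_smul]
      module
    rw [hder] at hprod
    refine hprod.congr (fun s hs => ?_) ?_
    · rw [Set.IccExtend_of_mem _ _ hs]
      simp [Z, Set.IccExtend_of_mem _ _ hs]
    · simp [Z]
  have hZ0 : Z 0 = f x := by simp [Z, hx0]
  -- Both sides solve the same linear Volterra equation, whose operator is injective.
  have huniq : fderiv 𝕜 Φ x (f x) = Z := by
    obtain ⟨u, hu⟩ := isUnit_one_sub_volterra (𝕜 := 𝕜) (G'.comp c)
    have hinj : Function.Injective (ContinuousLinearEquiv.ofUnit u) :=
      (ContinuousLinearEquiv.ofUnit u).injective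
    apply hinj
    have : ∀ y, ContinuousLinearEquiv.ofUnit u y =
        y - volterra 𝕜 _ (pointwiseApply 𝕜 unitInterval _ _ (G'.comp c) y) := fun y =>
      DFunLike.congr_fun hu y
    rw [this, this, hZ, hZ0, h3]
  rw [h4, huniq, hx2]
  simp [Z]

end TimeOneFlow

/-! ### Duality of shuffle and deshuffle. -/

section Deshuffle

variable {A K : Type*} [CommRing K]

/-- The list of the pairs of complementary subwords of a word. -/
def deshuffle : List A → List (List A × List A)
  | [] => [([], [])]
  | a :: w => (deshuffle w).map (fun p => (a :: p.1, p.2)) ++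
      (deshuffle w).map (fun p => (p.1, a :: p.2))

theorem perm_of_mem_deshuffle {w : List A} {p : List A × List A} (hp : p ∈ deshuffle w) :
    (p.1 ++ p.2).Perm w := by
  induction w generalizing p with
  | nil =>
    rw [deshuffle, List.mem_singleton] at hp
    subst hp
    exact List.Perm.refl _
  | cons a w ih =>
    rw [deshuffle, List.mem_append, List.mem_map, List.mem_map] at hp
    rcases hp with ⟨q, hq, rfl⟩ | ⟨q, hq, rfl⟩
    · exact (ih hq).cons a
    · exact List.perm_middle.trans ((ih hq).cons a)

theorem shuffle_nil_left (w : List A) : shuffle [] w = [w] := by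
  rw [shuffle]

theorem shuffle_nil_right (w : List A) : shuffle w [] = [w] := by
  cases w <;> rw [shuffle]
  simp

theorem shuffle_cons_cons (a b : A) (u w : List A) : shuffle (a :: u) (b :: w) =
    (shuffle u (b :: w)).map (fun z => a :: z) ++ (shuffle (a :: u) w).map (fun z => b :: z) := by
  rw [shuffle]

theorem count_map_cons [DecidableEq A] (a b : A) (w : List A) (l : List (List A)) :
    List.count (b :: w) (l.map fun z => a :: z) = if a = b then l.count w else 0 := by
  split_ifs with h
  · subst h
    exact List.count_map_of_injective l _ (List.cons_injective) w
  · refine List.count_eq_zero.2 fun hmem => ?_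
    obtain ⟨z, -, hz⟩ := List.mem_map.1 hmem
    exact h (List.cons.inj hz).1

theorem count_map_fst_cons [DecidableEq A] (a b : A) (u v : List A)
    (l : List (List A × List A)) :
    List.count (b :: u, v) (l.map fun p => (a :: p.1, p.2)) =
      if a = b then l.count (u, v) else 0 := by
  split_ifs with h
  · subst h
    refine List.count_map_of_injective l (fun p : List A × List A => (a :: p.1, p.2)) ?_ (u, v)
    rintro ⟨p, q⟩ ⟨p', q'⟩ h
    simpa using h
  · refine List.count_eq_zero.2 fun hmem => ?_
    obtain ⟨z, -, hz⟩ := List.mem_map.1 hmem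
    simp only [Prod.mk.injEq, List.cons.injEq] at hz
    exact h hz.1.1

theorem count_map_snd_cons [DecidableEq A] (a b : A) (u v : List A)
    (l : List (List A × List A)) :
    List.count (u, b :: v) (l.map fun p => (p.1, a :: p.2)) =
      if a = b then l.count (u, v) else 0 := by
  split_ifs with h
  · subst h
    refine List.count_map_of_injective l (fun p : List A × List A => (p.1, a :: p.2)) ?_ (u, v)
    rintro ⟨p, q⟩ ⟨p', q'⟩ h
    simpa using h
  · refine List.count_eq_zero.2 fun hmem => ?_
    obtain ⟨z, -, hz⟩ := List.mem_map.1 hmem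
    simp only [Prod.mk.injEq, List.cons.injEq] at hz
    exact h hz.2.1

/-- The deshuffle is dual to the shuffle product. -/
theorem count_deshuffle [DecidableEq A] (w u v : List A) :
    (deshuffle w).count (u, v) = (shuffle u v).count w := by
  induction w generalizing u v with
  | nil =>
    rw [deshuffle]
    cases u with
    | nil =>
      rw [shuffle_nil_left]
      cases v <;> simp
    | cons a u =>
      cases v with
      | nil => simp [shuffle_nil_right]
      | cons b v =>
        rw [shuffle_cons_cons, List.count_append, List.count_eq_zero.2, List.count_eq_zero.2,
          List.count_eq_zero.2] <;> simp
  | cons c w ih =>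
    rw [deshuffle, List.count_append]
    cases u with
    | nil =>
      have h0 : List.count ([], v) ((deshuffle w).map fun p => (c :: p.1, p.2)) = 0 :=
        List.count_eq_zero.2 (by simp)
      rw [h0, shuffle_nil_left]
      cases v with
      | nil =>
        rw [List.count_eq_zero.2 (by simp), List.count_eq_zero.2 (by simp)]
      | cons b v =>
        rw [count_map_snd_cons, ih, shuffle_nil_left, zero_add, List.count_singleton,
          List.count_singleton]
        by_cases h : c = b
        · simp [h]
        · simp [h, Ne.symm h]
    | cons a u =>
      rw [count_map_fst_cons, ih]
      cases v with
      | nil =>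
        have h0 : List.count (a :: u, []) ((deshuffle w).map fun p => (p.1, c :: p.2)) = 0 :=
          List.count_eq_zero.2 (by simp)
        rw [h0, shuffle_nil_right, shuffle_nil_right, List.count_singleton,
          List.count_singleton]
        by_cases h : c = a
        · simp [h]
        · simp [h, Ne.symm h]
      | cons b v =>
        rw [count_map_snd_cons, ih, shuffle_cons_cons, List.count_append, count_map_cons,
          count_map_cons]
        simp only [eq_comm]

/-- By duality this reduces to the deshuffle, where the induction on one word is immediate. -/
theorem perm_of_mem_shuffle {u v w : List A} (h : w ∈ shuffle u v) : w.Perm (u ++ v) := by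
  classical
  have : (u, v) ∈ deshuffle w := by
    rw [← List.count_pos_iff, count_deshuffle, List.count_pos_iff]
    exact h
  exact (perm_of_mem_deshuffle this).symm

theorem sum_map_eq_sum_count {ι : Type*} [BEq ι] [LawfulBEq ι] (l : List ι) (φ : ι → K)
    (s : Finset ι) (hs : ∀ i ∈ l, i ∈ s) : (l.map φ).sum = ∑ i ∈ s, (l.count i : K) * φ i := by
  classical
  induction l with
  | nil => simp
  | cons a l ih =>
    rw [List.map_cons, List.sum_cons, ih fun i hi => hs i (List.mem_cons_of_mem a hi)]
    simp only [List.count_cons, beq_iff_eq, Nat.cast_add, Nat.cast_ite, Nat.cast_one,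
      Nat.cast_zero, add_mul, ite_mul, one_mul, zero_mul, Finset.sum_add_distrib,
      Finset.sum_ite_eq, if_pos (hs a List.mem_cons_self)]
    ring

open Classical in
/-- Summation over the words of given content, deshuffled, against summation over pairs of
words, shuffled. -/
theorem sum_wordsOf_deshuffle (m : A →₀ ℕ) (δ : List A → K) (φ : List A → List A → K) :
    ∑ w ∈ wordsOf m, δ w * ((deshuffle w).map fun p => φ p.1 p.2).sum =
      ∑ q ∈ Finset.HasAntidiagonal.antidiagonal m, ∑ u ∈ wordsOf q.1, ∑ v ∈ wordsOf q.2,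
        ((shuffle u v).map δ).sum * φ u v := by
  -- These are the pairs of words with joint content `m`. Summed over them, both sides become a
  -- double sum over words and pairs, weighted by multiplicities that `count_deshuffle` identifies.
  let s : Finset (List A × List A) :=
    (Finset.HasAntidiagonal.antidiagonal m).biUnion fun q => wordsOf q.1 ×ˢ wordsOf q.2
  have hmem : ∀ p : List A × List A, p ∈ s ↔ ((p.1 ++ p.2 : List A) : Multiset A) =
      Finsupp.toMultiset m := by
    intro p
    simp only [s, Finset.mem_biUnion, Finset.mem_product, mem_wordsOf, Finset.HasAntidiagonal.mem_antidiagonal]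
    constructor
    · rintro ⟨q, hq, h1, h2⟩
      rw [← hq, map_add, ← h1, ← h2, Multiset.coe_add]
    · intro h
      refine ⟨(Multiset.toFinsupp (p.1 : Multiset A), Multiset.toFinsupp (p.2 : Multiset A)),
        ?_, by simp, by simp⟩
      rw [← map_add, Multiset.coe_add, h, Finsupp.toMultiset_toFinsupp]
  have hdisj : Set.PairwiseDisjoint (↑(Finset.HasAntidiagonal.antidiagonal m))
      fun q : (A →₀ ℕ) × (A →₀ ℕ) => wordsOf q.1 ×ˢ wordsOf q.2 := by
    intro q _ q' _ hne
    rw [Function.onFun, Finset.disjoint_left]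
    intro p hp hp'
    rw [Finset.mem_product, mem_wordsOf, mem_wordsOf] at hp hp'
    exact hne (Prod.ext (Multiset.toFinsupp.symm.injective (hp.1.symm.trans hp'.1))
      (Multiset.toFinsupp.symm.injective (hp.2.symm.trans hp'.2)))
  have hR : ∑ q ∈ Finset.HasAntidiagonal.antidiagonal m, ∑ u ∈ wordsOf q.1, ∑ v ∈ wordsOf q.2,
        ((shuffle u v).map δ).sum * φ u v =
      ∑ p ∈ s, ((shuffle p.1 p.2).map δ).sum * φ p.1 p.2 := by
    rw [Finset.sum_biUnion hdisj]
    refine Finset.sum_congr rfl fun q _ => ?_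
    rw [Finset.sum_product]
  rw [hR]
  have h1 : ∀ w ∈ wordsOf m, δ w * ((deshuffle w).map fun p => φ p.1 p.2).sum =
      ∑ p ∈ s, ((shuffle p.1 p.2).count w : K) * δ w * φ p.1 p.2 := by
    intro w hw
    rw [sum_map_eq_sum_count (deshuffle w) _ s, Finset.mul_sum]
    · refine Finset.sum_congr rfl fun p _ => ?_
      have hcount : (deshuffle w).count p = (shuffle p.1 p.2).count w := by
        convert count_deshuffle w p.1 p.2
      rw [hcount]
      ring
    · intro p hp
      rw [hmem, ← (mem_wordsOf m w).1 hw]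
      exact Multiset.coe_eq_coe.2 (perm_of_mem_deshuffle hp)
  rw [Finset.sum_congr rfl h1, Finset.sum_comm]
  refine Finset.sum_congr rfl fun p hp => ?_
  rw [← Finset.sum_mul, sum_map_eq_sum_count (shuffle p.1 p.2) _ (wordsOf m)]
  intro w hw
  rw [mem_wordsOf, ← (hmem p).1 hp]
  exact Multiset.coe_eq_coe.2 (perm_of_mem_shuffle hw)

theorem length_of_mem_wordsOf {m : A →₀ ℕ} {w : List A} (hw : w ∈ wordsOf m) :
    w.length = m.degree := by
  have := congrArg Multiset.card ((mem_wordsOf m w).1 hw)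
  rwa [Multiset.coe_card, Finsupp.card_toMultiset] at this

theorem wordsOf_zero : wordsOf (0 : A →₀ ℕ) = {[]} := by
  ext w
  rw [mem_wordsOf, map_zero, Finset.mem_singleton, Multiset.coe_eq_zero]

theorem nil_mem_wordsOf {m : A →₀ ℕ} : [] ∈ wordsOf m ↔ m = 0 := by
  rw [mem_wordsOf, Multiset.coe_nil, eq_comm]
  classical exact Multiset.toFinsupp.symm.injective.eq_iff' (map_zero _)

variable {d : ℕ} (ν : Fin d → A → K) (v : Fin d → K)

theorem nuWord_nil : nuWord ν v [] = 0 := rfl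

theorem nuWord_cons (l : A) (w : List A) :
    nuWord ν v (l :: w) = (∑ j, v j * ν j l) + nuWord ν v w := by
  simp [nuWord]

theorem nuWord_of_mem_shuffle {u w z : List A} (h : z ∈ shuffle u w) :
    nuWord ν v z = nuWord ν v u + nuWord ν v w := by
  rw [nuWord, ((perm_of_mem_shuffle h).map _).sum_eq, List.map_append, List.sum_append]
  rfl

end Deshuffle

/-! ### Stability of `𝒢` and `𝔤` under `Ξ_v`. -/

section Xi

variable {𝕜 : Type*} [RCLike 𝕜] {A : Type*} {d : ℕ} (ν : Fin d → A → 𝕜) (v : Fin d → 𝕜)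

/-- All terms of a shuffle have the same letters, hence the same eigenvalue, which factors out of
the sum. -/
theorem sum_map_XiOp_shuffle (δ : List A → 𝕜) (u w : List A) :
    ((shuffle u w).map (XiOp ν v δ)).sum =
      NormedSpace.exp (nuWord ν v u + nuWord ν v w) * ((shuffle u w).map δ).sum := by
  rw [← List.sum_map_mul_left]
  congr 1
  refine List.map_congr_left fun z hz => ?_
  rw [XiOp, nuWord_of_mem_shuffle ν v hz]

theorem XiOp_mem_groupG {γ : List A → 𝕜} (hγ : γ ∈ groupG A 𝕜) : XiOp ν v γ ∈ groupG A 𝕜 := by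
  refine ⟨by simp [XiOp, nuWord_nil, hγ.1], fun u w => ?_⟩
  rw [sum_map_XiOp_shuffle, ← hγ.2, NormedSpace.exp_add, XiOp, XiOp]
  ring

theorem XiOp_mem_algebraG {β : List A → 𝕜} (hβ : β ∈ algebraG A 𝕜) :
    XiOp ν v β ∈ algebraG A 𝕜 := by
  refine ⟨by simp [XiOp, hβ.1], fun u w hu hw => ?_⟩
  rw [sum_map_XiOp_shuffle, hβ.2 u w hu hw, mul_zero]

end Xi

/-! ### Differential operators of words. -/

section IteratedDerivation

variable {𝕜 : Type*} [RCLike 𝕜] {A : Type*} {E F : Type*} [NormedAddCommGroup E]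
  [NormedSpace 𝕜 E] [NormedAddCommGroup F] [NormedSpace 𝕜 F]

/-- The differential operator of a word: the composition of the derivations along the vector
fields of its letters. -/
def iterD (𝕜 : Type*) [RCLike 𝕜] {A E F : Type*} [NormedAddCommGroup E] [NormedSpace 𝕜 E]
    [NormedAddCommGroup F] [NormedSpace 𝕜 F] (f : A → E → E) : List A → (E → F) → E → F
  | [], H => H
  | l :: w, H => fun x => fderiv 𝕜 (iterD 𝕜 f w H) x (f l x)

@[simp]
theorem iterD_nil (f : A → E → E) (H : E → F) : iterD 𝕜 f [] H = H := rfl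

theorem iterD_cons (f : A → E → E) (l : A) (w : List A) (H : E → F) (x : E) :
    iterD 𝕜 f (l :: w) H x = fderiv 𝕜 (iterD 𝕜 f w H) x (f l x) := rfl

theorem wordBasis_eq_iterD {D : ℕ} (f : A → (Fin D → 𝕜) → (Fin D → 𝕜)) (w : List A) :
    wordBasis f w = iterD 𝕜 f w id := by
  induction w with
  | nil => rfl
  | cons l w ih =>
    funext x
    rw [wordBasis, ih]
    rfl

theorem contDiffOn_fderiv_apply {U : Set E} (hU : IsOpen U) {H : E → F}
    (hH : ContDiffOn 𝕜 ∞ H U) {V : E → E} (hV : ContDiff 𝕜 ∞ V) :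
    ContDiffOn 𝕜 ∞ (fun x => fderiv 𝕜 H x (V x)) U :=
  (hH.fderiv_of_isOpen hU (by simp)).clm_apply hV.contDiffOn

theorem iterD_const {f : A → E → E} {U : Set E} (hU : IsOpen U) (c : F) {w : List A}
    (hw : w ≠ []) :
    Set.EqOn (iterD 𝕜 f w fun _ => c) 0 U := by
  induction w with
  | nil => exact absurd rfl hw
  | cons l w ih =>
    intro x hx
    rw [iterD_cons]
    cases w with
    | nil => simp
    | cons l' w =>
      rw [((ih (by simp)).eventuallyEq_of_mem (hU.mem_nhds hx)).fderiv_eq]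
      simp

variable {f : A → E → E} (hf : ∀ l, ContDiff 𝕜 ∞ (f l)) {U : Set E} (hU : IsOpen U)
include hf hU

/-- The open set `U` is needed because the operators will act on the flow, whose smoothness is
available on its domain. -/
theorem contDiffOn_iterD {H : E → F} (hH : ContDiffOn 𝕜 ∞ H U) (w : List A) :
    ContDiffOn 𝕜 ∞ (iterD 𝕜 f w H) U := by
  induction w with
  | nil => exact hH
  | cons l w ih => exact contDiffOn_fderiv_apply hU ih (hf l)

theorem iterD_clm_comp {G : Type*} [NormedAddCommGroup G] [NormedSpace 𝕜 G] (L : F →L[𝕜] G)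
    {H : E → F} (hH : ContDiffOn 𝕜 ∞ H U) (w : List A) :
    Set.EqOn (iterD 𝕜 f w fun y => L (H y)) (fun y => L (iterD 𝕜 f w H y)) U := by
  induction w with
  | nil => exact fun _ _ => rfl
  | cons l w ih =>
    intro x hx
    have hd := differentiableAt_of_contDiffOn hU (contDiffOn_iterD hf hU hH w) hx
    rw [iterD_cons, (ih.eventuallyEq_of_mem (hU.mem_nhds hx)).fderiv_eq]
    have h := L.hasFDerivAt.comp x hd.hasFDerivAt
    rw [show (fun y => L (iterD 𝕜 f w H y)) = L ∘ iterD 𝕜 f w H from rfl, h.fderiv]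
    rfl

theorem iterD_sum {ι : Type*} (s : Finset ι) {H : ι → E → F}
    (hH : ∀ i ∈ s, ContDiffOn 𝕜 ∞ (H i) U) (w : List A) :
    Set.EqOn (iterD 𝕜 f w fun y => ∑ i ∈ s, H i y) (fun y => ∑ i ∈ s, iterD 𝕜 f w (H i) y) U := by
  induction w with
  | nil => exact fun _ _ => rfl
  | cons l w ih =>
    intro x hx
    rw [iterD_cons, (ih.eventuallyEq_of_mem (hU.mem_nhds hx)).fderiv_eq, fderiv_fun_sum]
    · simp [iterD_cons]
    · exact fun i hi => differentiableAt_of_contDiffOn hU (contDiffOn_iterD hf hU (hH i hi) w) hx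

theorem iterD_sub {H₁ H₂ : E → F} (h₁ : ContDiffOn 𝕜 ∞ H₁ U) (h₂ : ContDiffOn 𝕜 ∞ H₂ U)
    (w : List A) :
    Set.EqOn (iterD 𝕜 f w fun y => H₁ y - H₂ y)
      (fun y => iterD 𝕜 f w H₁ y - iterD 𝕜 f w H₂ y) U := by
  induction w with
  | nil => exact fun _ _ => rfl
  | cons l w ih =>
    intro x hx
    rw [iterD_cons, (ih.eventuallyEq_of_mem (hU.mem_nhds hx)).fderiv_eq, fderiv_fun_sub]
    · rfl
    · exact differentiableAt_of_contDiffOn hU (contDiffOn_iterD hf hU h₁ w) hx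
    · exact differentiableAt_of_contDiffOn hU (contDiffOn_iterD hf hU h₂ w) hx

/-- Leibniz rule for the differential operator of a word. -/
theorem iterD_mul {H₁ H₂ : E → 𝕜} (h₁ : ContDiffOn 𝕜 ∞ H₁ U) (h₂ : ContDiffOn 𝕜 ∞ H₂ U)
    (w : List A) :
    Set.EqOn (iterD 𝕜 f w fun y => H₁ y * H₂ y)
      (fun y => ((deshuffle w).map fun p => iterD 𝕜 f p.1 H₁ y * iterD 𝕜 f p.2 H₂ y).sum) U := by
  induction w with
  | nil => exact fun _ _ => by simp [deshuffle]
  | cons l w ih =>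
    intro x hx
    rw [iterD_cons, (ih.eventuallyEq_of_mem (hU.mem_nhds hx)).fderiv_eq]
    have hd₁ : ∀ u, HasFDerivAt (iterD 𝕜 f u H₁) (fderiv 𝕜 (iterD 𝕜 f u H₁) x) x := fun u =>
      (differentiableAt_of_contDiffOn hU (contDiffOn_iterD hf hU h₁ u) hx).hasFDerivAt
    have hd₂ : ∀ u, HasFDerivAt (iterD 𝕜 f u H₂) (fderiv 𝕜 (iterD 𝕜 f u H₂) x) x := fun u =>
      (differentiableAt_of_contDiffOn hU (contDiffOn_iterD hf hU h₂ u) hx).hasFDerivAt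
    have hlist : ∀ L : List (List A × List A), HasFDerivAt
        (fun y => (L.map fun p => iterD 𝕜 f p.1 H₁ y * iterD 𝕜 f p.2 H₂ y).sum)
        ((L.map fun p => iterD 𝕜 f p.1 H₁ x • fderiv 𝕜 (iterD 𝕜 f p.2 H₂) x +
          iterD 𝕜 f p.2 H₂ x • fderiv 𝕜 (iterD 𝕜 f p.1 H₁) x).sum) x := by
      intro L
      induction L with
      | nil => simpa using hasFDerivAt_const (0 : 𝕜) x
      | cons p L ihL =>
        simp only [List.map_cons, List.sum_cons]
        exact ((hd₁ p.1).mul (hd₂ p.2)).add ihL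
    rw [(hlist _).fderiv]
    have happ : ∀ L : List (E →L[𝕜] 𝕜), L.sum (f l x) = (L.map fun T => T (f l x)).sum := by
      intro L
      induction L with
      | nil => simp
      | cons T L ihL => simp [ihL]
    rw [happ]
    -- The product rule hands the new letter to one of the two factors, which is the recursion of
    -- `deshuffle`.
    simp only [deshuffle, List.map_append, List.sum_append, List.map_map, Function.comp_def,
      add_apply, smul_apply, smul_eq_mul, iterD_cons,
      List.sum_map_add]
    rw [add_comm]
    simp only [mul_comm]

/-- The differential operator of a word of length at most `n` kills the maps that are flat to
order `n`. -/
theorem iterD_eq_zero_of_flat {H : E → F} (hH : ContDiffOn 𝕜 ∞ H U) {x : E} (hx : x ∈ U)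
    (w : List A) : ∀ n, (∀ k ≤ n + w.length, iteratedFDeriv 𝕜 k H x = 0) →
      ∀ k ≤ n, iteratedFDeriv 𝕜 k (iterD 𝕜 f w H) x = 0 := by
  induction w with
  | nil => exact fun n h => h
  | cons l w ih =>
    intro n h k hk
    have hw := contDiffOn_iterD hf hU hH w
    have hflat := ih (n + 1) (fun k hk => h k (by rw [List.length_cons]; omega))
    -- Each summand of the Leibniz bound contains a derivative of `iterD 𝕜 f w H` of order between
    -- `1` and `n + 1`, and these vanish at `x`; hence the flatness hypothesis at `n + 1`.
    have hbound := (ContinuousLinearMap.id 𝕜 (E →L[𝕜] F)).norm_iteratedFDerivWithin_le_of_bilinear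
      (hw.fderiv_of_isOpen hU (m := ∞) (by simp)) (hf l).contDiffOn hU.uniqueDiffOn hx
      (natCast_le_infty k)
    simp only [iteratedFDerivWithin_of_isOpen _ hU hx, ContinuousLinearMap.id_apply,
      norm_iteratedFDeriv_fderiv] at hbound
    rw [Finset.sum_eq_zero, mul_zero] at hbound
    · exact norm_le_zero_iff.1 hbound
    · intro i hi
      rw [hflat (i + 1) (by have := Finset.mem_range.1 hi; omega)]
      simp

/-- The remainder `H - taylorSum 𝕜 H x N` is flat to order `N` at `x`, so operators of order at most
`N` do not see it. -/
theorem iterD_taylorSum {H : E → F} (hH : ContDiffOn 𝕜 ∞ H U) {x : E} (hx : x ∈ U)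
    {w : List A} {N : ℕ} (hw : w.length ≤ N) :
    iterD 𝕜 f w (taylorSum 𝕜 H x N) x = iterD 𝕜 f w H x := by
  have hT : ContDiffOn 𝕜 ∞ (taylorSum 𝕜 H x N) U := (contDiff_taylorSum H x N).contDiffOn
  have h := iterD_eq_zero_of_flat hf hU (hH.sub hT) hx w 0 (fun k hk => ?_) 0 le_rfl
  · have h0 := congrArg (fun M => M (fun i : Fin 0 => i.elim0)) h
    simp only [iteratedFDeriv_zero_apply, zero_apply] at h0
    exact (sub_eq_zero.1 ((iterD_sub hf hU hH hT w hx).symm.trans h0)).symm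
  · have hle := natCast_le_infty k
    have := iteratedFDeriv_sub_apply (((hH.contDiffAt (hU.mem_nhds hx)).of_le hle))
      ((hT.contDiffAt (hU.mem_nhds hx)).of_le hle)
    exact this.trans (by rw [iteratedFDeriv_taylorSum hU hH hx (by omega), sub_self])

end IteratedDerivation

/-! ### Operator series: multiplicativity, derivation property and substitution. -/

section Series

variable {𝕜 : Type*} [RCLike 𝕜] {A : Type*} {D : ℕ}

/-- The series `∑_w δ_w D_w H`, evaluated at a point, for a scalar function `H`. -/
def seriesOf (f : A → (Fin D → 𝕜) → (Fin D → 𝕜)) (δ : List A → 𝕜) (H : (Fin D → 𝕜) → 𝕜)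
    (x : Fin D → 𝕜) : MvPowerSeries A 𝕜 :=
  fun m => ∑ w ∈ wordsOf m, δ w * iterD 𝕜 f w H x

theorem coeff_seriesOf (f : A → (Fin D → 𝕜) → (Fin D → 𝕜)) (δ : List A → 𝕜)
    (H : (Fin D → 𝕜) → 𝕜) (x : Fin D → 𝕜) (m : A →₀ ℕ) :
    MvPowerSeries.coeff m (seriesOf f δ H x) = ∑ w ∈ wordsOf m, δ w * iterD 𝕜 f w H x := rfl

variable (𝕜 A) in
open Classical in
/-- The coefficients of the identity map. -/
def unitCoeff (w : List A) : 𝕜 := if w = [] then 1 else 0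

theorem seriesOf_unitCoeff (f : A → (Fin D → 𝕜) → (Fin D → 𝕜)) (H : (Fin D → 𝕜) → 𝕜)
    (x : Fin D → 𝕜) : seriesOf f (unitCoeff 𝕜 A) H x = MvPowerSeries.C (H x) := by
  classical
  ext m
  rw [coeff_seriesOf, MvPowerSeries.coeff_C]
  simp only [unitCoeff, ite_mul, one_mul, zero_mul, Finset.sum_ite_eq', nil_mem_wordsOf, iterD_nil]

open Classical in
theorem coeff_seriesOf_mul_seriesOf (f : A → (Fin D → 𝕜) → (Fin D → 𝕜)) (δ₁ δ₂ : List A → 𝕜)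
    (H₁ H₂ : (Fin D → 𝕜) → 𝕜) (x : Fin D → 𝕜) (m : A →₀ ℕ) :
    MvPowerSeries.coeff m (seriesOf f δ₁ H₁ x * seriesOf f δ₂ H₂ x) =
      ∑ q ∈ Finset.HasAntidiagonal.antidiagonal m, ∑ u ∈ wordsOf q.1, ∑ v ∈ wordsOf q.2,
        δ₁ u * δ₂ v * (iterD 𝕜 f u H₁ x * iterD 𝕜 f v H₂ x) := by
  rw [MvPowerSeries.coeff_mul]
  refine Finset.sum_congr rfl fun q _ => ?_
  rw [coeff_seriesOf, coeff_seriesOf, Finset.sum_mul_sum]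
  exact Finset.sum_congr rfl fun u _ => Finset.sum_congr rfl fun v _ => by ring

theorem eval_wordSeries_eq_seriesOf {f : A → (Fin D → 𝕜) → (Fin D → 𝕜)}
    (hf : ∀ l, ContDiff 𝕜 ∞ (f l)) (δ : List A → 𝕜) (x : Fin D → 𝕜) (i : Fin D) :
    (wordSeries f δ).eval x i = seriesOf f δ (fun y => y i) x := by
  ext m
  rw [coeff_seriesOf]
  change (∑ w ∈ wordsOf m, δ w • wordBasis f w x) i = _
  rw [Finset.sum_apply]
  refine Finset.sum_congr rfl fun w _ => ?_
  have h := iterD_clm_comp hf isOpen_univ (ContinuousLinearMap.proj (R := 𝕜)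
    (φ := fun _ : Fin D => 𝕜) i) (H := id) contDiff_id.contDiffOn w (Set.mem_univ x)
  simp only [ContinuousLinearMap.proj_apply, id] at h
  rw [h, wordBasis_eq_iterD]
  rfl

theorem seriesOf_const (f : A → (Fin D → 𝕜) → (Fin D → 𝕜)) (δ : List A → 𝕜) (c : 𝕜)
    (x : Fin D → 𝕜) : seriesOf f δ (fun _ => c) x = MvPowerSeries.C (δ [] * c) := by
  classical
  ext m
  rw [coeff_seriesOf, MvPowerSeries.coeff_C]
  split_ifs with hm
  · subst hm
    simp [wordsOf_zero]
  · refine Finset.sum_eq_zero fun w hw => ?_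
    have : w ≠ [] := by
      rintro rfl
      exact hm (nil_mem_wordsOf.1 hw)
    rw [iterD_const isOpen_univ c this (Set.mem_univ x), Pi.zero_apply, mul_zero]

variable {f : A → (Fin D → 𝕜) → (Fin D → 𝕜)} (hf : ∀ l, ContDiff 𝕜 ∞ (f l))
include hf

theorem seriesOf_sub_const (δ : List A → 𝕜) {H : (Fin D → 𝕜) → 𝕜} (hH : ContDiff 𝕜 ∞ H) (c : 𝕜)
    (x : Fin D → 𝕜) :
    seriesOf f δ (fun y => H y - c) x = seriesOf f δ H x - MvPowerSeries.C (δ [] * c) := by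
  rw [← seriesOf_const f δ c x]
  ext m
  rw [map_sub, coeff_seriesOf, coeff_seriesOf, coeff_seriesOf, ← Finset.sum_sub_distrib]
  refine Finset.sum_congr rfl fun w _ => ?_
  rw [iterD_sub hf isOpen_univ hH.contDiffOn contDiff_const.contDiffOn w (Set.mem_univ x), mul_sub]

open Classical in
theorem coeff_seriesOf_mul (δ : List A → 𝕜) {H₁ H₂ : (Fin D → 𝕜) → 𝕜} (h₁ : ContDiff 𝕜 ∞ H₁)
    (h₂ : ContDiff 𝕜 ∞ H₂) (x : Fin D → 𝕜) (m : A →₀ ℕ) :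
    MvPowerSeries.coeff m (seriesOf f δ (fun y => H₁ y * H₂ y) x) =
      ∑ q ∈ Finset.HasAntidiagonal.antidiagonal m, ∑ u ∈ wordsOf q.1, ∑ v ∈ wordsOf q.2,
        ((shuffle u v).map δ).sum * (iterD 𝕜 f u H₁ x * iterD 𝕜 f v H₂ x) := by
  rw [coeff_seriesOf, ← sum_wordsOf_deshuffle m δ fun u v => iterD 𝕜 f u H₁ x * iterD 𝕜 f v H₂ x]
  refine Finset.sum_congr rfl fun w _ => ?_
  rw [iterD_mul hf isOpen_univ h₁.contDiffOn h₂.contDiffOn w (Set.mem_univ x)]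

/-- A family in `𝒢` defines a multiplicative series of differential operators. -/
theorem seriesOf_mul_of_mem_groupG {γ : List A → 𝕜} (hγ : γ ∈ groupG A 𝕜)
    {H₁ H₂ : (Fin D → 𝕜) → 𝕜} (h₁ : ContDiff 𝕜 ∞ H₁) (h₂ : ContDiff 𝕜 ∞ H₂) (x : Fin D → 𝕜) :
    seriesOf f γ (fun y => H₁ y * H₂ y) x = seriesOf f γ H₁ x * seriesOf f γ H₂ x := by
  ext m
  rw [coeff_seriesOf_mul hf γ h₁ h₂, coeff_seriesOf_mul_seriesOf]
  simp only [hγ.2]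

/-- A family in `𝔤` defines a series of derivations. -/
theorem seriesOf_mul_of_mem_algebraG {β : List A → 𝕜} (hβ : β ∈ algebraG A 𝕜)
    {H₁ H₂ : (Fin D → 𝕜) → 𝕜} (h₁ : ContDiff 𝕜 ∞ H₁) (h₂ : ContDiff 𝕜 ∞ H₂) (x : Fin D → 𝕜) :
    seriesOf f β (fun y => H₁ y * H₂ y) x =
      MvPowerSeries.C (H₁ x) * seriesOf f β H₂ x + seriesOf f β H₁ x * MvPowerSeries.C (H₂ x) := by
  -- The defining relations of `𝔤`, extended to empty words: `β` is an infinitesimal character of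
  -- the shuffle algebra.
  have hsh : ∀ u v, ((shuffle u v).map β).sum = unitCoeff 𝕜 A u * β v + β u * unitCoeff 𝕜 A v := by
    intro u v
    by_cases hu : u = []
    · subst hu
      simp [shuffle_nil_left, unitCoeff, hβ.1]
    · by_cases hv : v = []
      · subst hv
        simp [shuffle_nil_right, unitCoeff, hβ.1]
      · simp [hβ.2 u v hu hv, unitCoeff, hu, hv]
  rw [← seriesOf_unitCoeff f, ← seriesOf_unitCoeff f]
  ext m
  rw [coeff_seriesOf_mul hf β h₁ h₂, map_add, coeff_seriesOf_mul_seriesOf,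
    coeff_seriesOf_mul_seriesOf]
  simp only [hsh, add_mul, Finset.sum_add_distrib]

omit hf in
theorem contDiff_prod_sub (x : Fin D → 𝕜) {k : ℕ} (j : Fin k → Fin D) :
    ContDiff 𝕜 ∞ fun y : Fin D → 𝕜 => ∏ r, (y (j r) - x (j r)) :=
  contDiff_prod fun r _ => (contDiff_apply 𝕜 𝕜 (j r)).sub contDiff_const

/-- Multiplicativity sends a monomial centred at `x` to the same monomial in `W_γ(x) - x`, the
increments used in `substMap`. -/
theorem seriesOf_prod_of_mem_groupG {γ : List A → 𝕜} (hγ : γ ∈ groupG A 𝕜) (x : Fin D → 𝕜) {k : ℕ}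
    (j : Fin k → Fin D) :
    seriesOf f γ (fun y => ∏ r, (y (j r) - x (j r))) x =
      ∏ r, ((wordSeries f γ).eval x (j r) - MvPowerSeries.C (x (j r))) := by
  induction k with
  | zero => simp [seriesOf_const, hγ.1]
  | succ k ih =>
    simp only [Fin.prod_univ_succ]
    rw [seriesOf_mul_of_mem_groupG hf hγ ((contDiff_apply 𝕜 𝕜 (j 0)).sub contDiff_const)
      (contDiff_prod_sub x fun r => j r.succ), ih fun r => j r.succ,
      seriesOf_sub_const hf γ (contDiff_apply 𝕜 𝕜 (j 0)), hγ.1, one_mul,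
      eval_wordSeries_eq_seriesOf hf]

/-- A derivation at `x` kills constants and products of two functions vanishing at `x`; only the
linear monomials survive. -/
theorem seriesOf_prod_of_mem_algebraG {β : List A → 𝕜} (hβ : β ∈ algebraG A 𝕜) (x : Fin D → 𝕜)
    {k : ℕ} (hk : k ≠ 1) (j : Fin k → Fin D) :
    seriesOf f β (fun y => ∏ r, (y (j r) - x (j r))) x = 0 := by
  cases k with
  | zero => simp [seriesOf_const, hβ.1]
  | succ k =>
    obtain ⟨k, rfl⟩ := Nat.exists_eq_succ_of_ne_zero (show k ≠ 0 by omega)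
    simp only [Fin.prod_univ_succ (n := k + 1)]
    rw [seriesOf_mul_of_mem_algebraG hf hβ ((contDiff_apply 𝕜 𝕜 (j 0)).sub contDiff_const)
      (contDiff_prod_sub x fun r => j r.succ), sub_self, Fin.prod_univ_succ, sub_self]
    simp

theorem seriesOf_apply_sub_of_mem_algebraG {β : List A → 𝕜} (hβ : β ∈ algebraG A 𝕜)
    (x : Fin D → 𝕜) (i : Fin D) :
    seriesOf f β (fun y => y i - x i) x = (wordSeries f β).eval x i := by
  rw [seriesOf_sub_const hf β (contDiff_apply 𝕜 𝕜 i), hβ.1, eval_wordSeries_eq_seriesOf hf]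
  simp

variable {F : Type*} [NormedAddCommGroup F] [NormedSpace 𝕜 F]

omit hf in
theorem taylorSum_eq_sum_coord (H : (Fin D → 𝕜) → F) (x : Fin D → 𝕜) (N : ℕ) (y : Fin D → 𝕜) :
    taylorSum 𝕜 H x N y = ∑ k ∈ Finset.range (N + 1), ∑ j : Fin k → Fin D,
      (∏ r, (y (j r) - x (j r))) • (k.factorial : 𝕜)⁻¹ •
        iteratedFDeriv 𝕜 k H x fun r => Pi.single (j r) 1 := by
  refine Finset.sum_congr rfl fun k _ => ?_
  have hyx : y - x = ∑ i, (y i - x i) • (Pi.single i 1 : Fin D → 𝕜) := by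
    simpa using pi_eq_sum_univ' (y - x)
  conv_lhs => rw [hyx]
  rw [ContinuousMultilinearMap.map_sum, Finset.smul_sum]
  refine Finset.sum_congr rfl fun j _ => ?_
  rw [ContinuousMultilinearMap.map_smul_univ, smul_comm]

/-- The action on `H` of a series of differential operators depends only on its action on the
monomials, through the Taylor expansion of `H`. -/
theorem sum_smul_iterD_eq {U : Set (Fin D → 𝕜)} (hU : IsOpen U) {H : (Fin D → 𝕜) → F}
    (hH : ContDiffOn 𝕜 ∞ H U) {x : Fin D → 𝕜} (hx : x ∈ U) (δ : List A → 𝕜) {m : A →₀ ℕ} {N : ℕ}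
    (hN : m.degree ≤ N) :
    ∑ w ∈ wordsOf m, δ w • iterD 𝕜 f w H x =
      ∑ k ∈ Finset.range (N + 1), ∑ j : Fin k → Fin D,
        MvPowerSeries.coeff m (seriesOf f δ (fun y => ∏ r, (y (j r) - x (j r))) x) •
          (k.factorial : 𝕜)⁻¹ • iteratedFDeriv 𝕜 k H x fun r => Pi.single (j r) 1 := by
  have key : ∀ w ∈ wordsOf m, δ w • iterD 𝕜 f w H x =
      ∑ k ∈ Finset.range (N + 1), ∑ j : Fin k → Fin D,
        (δ w * iterD 𝕜 f w (fun y => ∏ r, (y (j r) - x (j r))) x) •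
          (k.factorial : 𝕜)⁻¹ • iteratedFDeriv 𝕜 k H x fun r => Pi.single (j r) 1 := by
    intro w hw
    -- Words of content `m` have length `m.degree`, so the Taylor polynomial of degree `N` may
    -- replace `H`.
    rw [← iterD_taylorSum hf hU hH hx ((length_of_mem_wordsOf hw).trans_le hN),
      funext (taylorSum_eq_sum_coord H x N)]
    have hmono : ∀ (k : ℕ) (j : Fin k → Fin D) (c : F), ContDiffOn 𝕜 ∞
        (fun y : Fin D → 𝕜 => (∏ r, (y (j r) - x (j r))) • c) Set.univ := fun k j c =>
      ((contDiff_prod_sub x j).smul contDiff_const).contDiffOn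
    rw [iterD_sum hf isOpen_univ _
      (fun k _ => ContDiffOn.sum fun j _ => hmono k j _) w (Set.mem_univ x), Finset.smul_sum]
    refine Finset.sum_congr rfl fun k _ => ?_
    rw [iterD_sum hf isOpen_univ _ (fun j _ => hmono k j _) w (Set.mem_univ x), Finset.smul_sum]
    refine Finset.sum_congr rfl fun j _ => ?_
    have := iterD_clm_comp hf isOpen_univ (ContinuousLinearMap.toSpanSingleton 𝕜
      ((k.factorial : 𝕜)⁻¹ • iteratedFDeriv 𝕜 k H x fun r => Pi.single (j r) 1))
      (contDiff_prod_sub x j).contDiffOn w (Set.mem_univ x)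
    simp only [ContinuousLinearMap.toSpanSingleton_apply] at this
    rw [this, mul_smul]
  rw [Finset.sum_congr rfl key, Finset.sum_comm]
  refine Finset.sum_congr rfl fun k _ => ?_
  rw [Finset.sum_comm]
  refine Finset.sum_congr rfl fun j _ => ?_
  rw [← Finset.sum_smul, coeff_seriesOf]

/-- For `γ ∈ 𝒢`, the series of differential operators acts as the substitution of the word
series. -/
theorem substMap_wordSeries {U : Set (Fin D → 𝕜)} (hU : IsOpen U)
    {H : (Fin D → 𝕜) → (Fin D → 𝕜)} (hH : ContDiffOn 𝕜 ∞ H U) {x : Fin D → 𝕜} (hx : x ∈ U)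
    {γ : List A → 𝕜} (hγ : γ ∈ groupG A 𝕜) (i : Fin D) (m : A →₀ ℕ) :
    substMap H ((wordSeries f γ).eval x) i m = (∑ w ∈ wordsOf m, γ w • iterD 𝕜 f w H x) i := by
  have hconst : ∀ i, MvPowerSeries.constantCoeff ((wordSeries f γ).eval x i) = x i := by
    intro i
    rw [eval_wordSeries_eq_seriesOf hf, ← MvPowerSeries.coeff_zero_eq_constantCoeff_apply,
      coeff_seriesOf, wordsOf_zero]
    simp [hγ.1]
  -- The choice `N = m.degree` matches the truncation in `substMap`.
  rw [sum_smul_iterD_eq hf hU hH hx γ le_rfl, Finset.sum_apply]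
  unfold substMap
  refine Finset.sum_congr rfl fun k _ => ?_
  rw [Finset.sum_apply, Finset.mul_sum]
  refine Finset.sum_congr rfl fun j _ => ?_
  simp only [hconst]
  rw [seriesOf_prod_of_mem_groupG hf hγ]
  simp only [Pi.smul_apply, smul_eq_mul]
  ring

/-- For `β ∈ 𝔤`, the series of differential operators is the derivation along the word series. -/
theorem sum_smul_iterD_of_mem_algebraG {U : Set (Fin D → 𝕜)} (hU : IsOpen U)
    {H : (Fin D → 𝕜) → F} (hH : ContDiffOn 𝕜 ∞ H U) {x : Fin D → 𝕜} (hx : x ∈ U)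
    {β : List A → 𝕜} (hβ : β ∈ algebraG A 𝕜) (m : A →₀ ℕ) :
    ∑ w ∈ wordsOf m, β w • iterD 𝕜 f w H x = fderiv 𝕜 H x (wordSeries f β m x) := by
  rw [sum_smul_iterD_eq hf hU hH hx β (Nat.le_succ _), Finset.sum_eq_single 1]
  · rw [← (Equiv.funUnique (Fin 1) (Fin D)).symm.sum_comp]
    have hW : wordSeries f β m x = ∑ i, wordSeries f β m x i • (Pi.single i 1 : Fin D → 𝕜) := by
      simpa using pi_eq_sum_univ' (wordSeries f β m x)
    rw [hW, map_sum]
    refine Finset.sum_congr rfl fun i _ => ?_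
    simp only [Fin.prod_univ_one, Equiv.funUnique_symm_apply, uniqueElim_const]
    rw [seriesOf_apply_sub_of_mem_algebraG hf hβ, iteratedFDeriv_one_apply, map_smul]
    simp
    rfl
  · intro k _ hk
    refine Finset.sum_eq_zero fun j _ => ?_
    rw [seriesOf_prod_of_mem_algebraG hf hβ x hk, map_zero, zero_smul]
  · intro h
    simp at h

end Series

section Transport

variable {𝕜 : Type*} [RCLike 𝕜] {A : Type*} {D d : ℕ} {f : A → (Fin D → 𝕜) → (Fin D → 𝕜)}
  {g : Fin d → (Fin D → 𝕜) → (Fin D → 𝕜)} {ν : Fin d → A → 𝕜}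

theorem fderiv_sum_smul {E F ι : Type*} [NormedAddCommGroup E] [NormedSpace 𝕜 E]
    [NormedAddCommGroup F] [NormedSpace 𝕜 F] (s : Finset ι) (c : ι → 𝕜) {h : ι → E → F} {x : E}
    (hd : ∀ i ∈ s, DifferentiableAt 𝕜 (h i) x) :
    fderiv 𝕜 (fun y => ∑ i ∈ s, c i • h i y) x = ∑ i ∈ s, c i • fderiv 𝕜 (h i) x :=
  HasFDerivAt.fderiv (HasFDerivAt.fun_sum fun i hi => (hd i hi).hasFDerivAt.const_smul (c i))

theorem contDiff_gField (hg : ∀ j, ContDiff 𝕜 ∞ (g j)) (v : Fin d → 𝕜) :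
    ContDiff 𝕜 ∞ (gField g v) :=
  ContDiff.sum fun j _ => (contDiff_const (c := v j)).smul (hg j)

theorem lieBracket_gField (hg : ∀ j, ContDiff 𝕜 ∞ (g j))
    (heig : ∀ j l, VectorField.lieBracket 𝕜 (g j) (f l) = ν j l • f l) (v : Fin d → 𝕜) (l : A) :
    VectorField.lieBracket 𝕜 (gField g v) (f l) = (∑ j, v j * ν j l) • f l := by
  funext x
  have hd : ∀ j, DifferentiableAt 𝕜 (g j) x := fun j => (hg j).differentiable (by simp) x
  have hsum : fderiv 𝕜 (gField g v) x = ∑ j, v j • fderiv 𝕜 (g j) x :=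
    fderiv_sum_smul _ _ fun j _ => hd j
  have hj : ∀ j, v j • (fderiv 𝕜 (f l) x (g j x) - fderiv 𝕜 (g j) x (f l x)) =
      (v j * ν j l) • f l x := fun j => by
    rw [mul_smul]
    exact congrArg (v j • ·) (congrFun (heig j l) x)
  rw [VectorField.lieBracket, hsum, gField, map_sum, sum_apply,
    ← Finset.sum_sub_distrib, Pi.smul_apply, Finset.sum_smul]
  refine Finset.sum_congr rfl fun j _ => ?_
  rw [← hj, map_smul, smul_sub]
  rfl

variable (hf : ∀ l, ContDiff 𝕜 ∞ (f l))
include hf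

/-- Commutation of the derivation along `g^v` with the differential operator of a word. -/
theorem fderiv_iterD_gField (hg : ∀ j, ContDiff 𝕜 ∞ (g j))
    (heig : ∀ j l, VectorField.lieBracket 𝕜 (g j) (f l) = ν j l • f l) (v : Fin d → 𝕜)
    {F : Type*} [NormedAddCommGroup F] [NormedSpace 𝕜 F] {H : (Fin D → 𝕜) → F}
    (hH : ContDiff 𝕜 ∞ H) (w : List A) (x : Fin D → 𝕜) :
    fderiv 𝕜 (iterD 𝕜 f w H) x (gField g v x) =
      iterD 𝕜 f w (fun y => fderiv 𝕜 H y (gField g v y)) x + nuWord ν v w • iterD 𝕜 f w H x := by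
  have hV := contDiff_gField hg v
  have hsm : ∀ {H : (Fin D → 𝕜) → F}, ContDiff 𝕜 ∞ H → ∀ w, ContDiff 𝕜 ∞ (iterD 𝕜 f w H) :=
    fun hH w => contDiffOn_univ.1 (contDiffOn_iterD hf isOpen_univ hH.contDiffOn w)
  induction w generalizing x with
  | nil => simp [nuWord_nil]
  | cons l w ih =>
    have hb := VectorField.fderiv_apply_lieBracket (V := gField g v) (W := f l)
      ((hsm hH w).contDiffAt (x := x)) (n := ∞)
      (by simpa using natCast_le_infty 2) ((hf l).differentiable (by simp) x)
      (hV.differentiable (by simp) x)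
    rw [lieBracket_gField hg heig, Pi.smul_apply, map_smul] at hb
    have hDV : ContDiff 𝕜 ∞ fun y => fderiv 𝕜 H y (gField g v y) :=
      (hH.fderiv_right (by simp)).clm_apply hV
    have hsum : fderiv 𝕜 (fun y => iterD 𝕜 f w (fun y => fderiv 𝕜 H y (gField g v y)) y +
        nuWord ν v w • iterD 𝕜 f w H y) x = fderiv 𝕜 (iterD 𝕜 f w fun y =>
          fderiv 𝕜 H y (gField g v y)) x + nuWord ν v w • fderiv 𝕜 (iterD 𝕜 f w H) x :=
      HasFDerivAt.fderiv (((hsm hDV w).differentiable (by simp) x).hasFDerivAt.add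
        (((hsm hH w).differentiable (by simp) x).hasFDerivAt.const_smul _))
    rw [funext ih, hsum] at hb
    change fderiv 𝕜 (fun y => fderiv 𝕜 (iterD 𝕜 f w H) y (f l y)) x (gField g v x) = _
    rw [eq_sub_iff_add_eq] at hb
    rw [← hb, nuWord_cons, iterD_cons, iterD_cons]
    simp only [add_apply, smul_apply]
    module

/-- The differential operators of words act on a map that transports the vector fields to
multiples of themselves. -/
theorem iterD_of_transport {U : Set (Fin D → 𝕜)} (hU : IsOpen U) {φ : (Fin D → 𝕜) → (Fin D → 𝕜)}
    (hφ : ContDiffOn 𝕜 ∞ φ U) (v : Fin d → 𝕜)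
    (h : ∀ l, ∀ x ∈ U, fderiv 𝕜 φ x (f l x) =
      NormedSpace.exp (-∑ j, v j * ν j l) • f l (φ x)) (w : List A) :
    Set.EqOn (iterD 𝕜 f w φ)
      (fun x => NormedSpace.exp (-nuWord ν v w) • wordBasis f w (φ x)) U := by
  induction w with
  | nil => exact fun x _ => by simp [nuWord_nil, wordBasis]
  | cons l w ih =>
    intro x hx
    have hw : DifferentiableAt 𝕜 (wordBasis f w) (φ x) := by
      rw [wordBasis_eq_iterD]
      exact differentiableAt_of_contDiffOn isOpen_univ
        (contDiffOn_iterD hf isOpen_univ contDiff_id.contDiffOn w) (Set.mem_univ _)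
    have hφx := differentiableAt_of_contDiffOn hU hφ hx
    have hcomp := (hw.hasFDerivAt.comp x hφx.hasFDerivAt).const_smul
      (NormedSpace.exp (-nuWord ν v w))
    have hfd : fderiv 𝕜 (fun x => NormedSpace.exp (-nuWord ν v w) • wordBasis f w (φ x)) x =
        NormedSpace.exp (-nuWord ν v w) • (fderiv 𝕜 (wordBasis f w) (φ x) ∘L fderiv 𝕜 φ x) :=
      hcomp.fderiv
    rw [iterD_cons, (ih.eventuallyEq_of_mem (hU.mem_nhds hx)).fderiv_eq, hfd, smul_apply,
      ContinuousLinearMap.comp_apply, h l x hx, map_smul, smul_smul, nuWord_cons, neg_add,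
      NormedSpace.exp_add, mul_comm]
    rfl

end Transport

namespace FormalMap

variable {𝕜 : Type*} [RCLike 𝕜] {A : Type*} {D : ℕ}

theorem eval_ofMap (F : (Fin D → 𝕜) → (Fin D → 𝕜)) (x : Fin D → 𝕜) (i : Fin D) :
    (ofMap F : FormalMap 𝕜 A D).eval x i = MvPowerSeries.C (F x i) := by
  classical
  ext m
  rw [MvPowerSeries.coeff_C]
  change (if m = 0 then F else 0 : (Fin D → 𝕜) → (Fin D → 𝕜)) x i = _
  split_ifs <;> rfl

theorem jacobian_ofMap (F : (Fin D → 𝕜) → (Fin D → 𝕜)) (x : Fin D → 𝕜) :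
    (ofMap F : FormalMap 𝕜 A D).jacobian x =
      (LinearMap.toMatrix' (fderiv 𝕜 F x : (Fin D → 𝕜) →ₗ[𝕜] (Fin D → 𝕜))).map
        (MvPowerSeries.C (σ := A)) := by
  classical
  ext i j m
  rw [Matrix.map_apply, MvPowerSeries.coeff_C]
  change fderiv 𝕜 (if m = 0 then F else 0 : (Fin D → 𝕜) → (Fin D → 𝕜)) x (Pi.single j 1) i = _
  split_ifs
  · rw [LinearMap.toMatrix'_apply]
    rfl
  · simp

theorem isUnit_det_jacobian_ofMap {F : (Fin D → 𝕜) → (Fin D → 𝕜)} {x : Fin D → 𝕜}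
    (hF : Function.Injective (fderiv 𝕜 F x)) :
    IsUnit ((ofMap F : FormalMap 𝕜 A D).jacobian x).det := by
  rw [jacobian_ofMap, ← RingHom.mapMatrix_apply, ← RingHom.map_det]
  refine IsUnit.map _ ?_
  rw [LinearMap.det_toMatrix', ← LinearMap.isUnit_iff_isUnit_det, LinearMap.isUnit_iff_ker_eq_bot]
  exact LinearMap.ker_eq_bot.2 hF

theorem jacobian_ofMap_mulVec (F : (Fin D → 𝕜) → (Fin D → 𝕜)) (x : Fin D → 𝕜)
    (X : FormalVec 𝕜 A D) (i : Fin D) (m : A →₀ ℕ) :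
    MvPowerSeries.coeff m (((ofMap F).jacobian x).mulVec X i) =
      fderiv 𝕜 F x (fun j => MvPowerSeries.coeff m (X j)) i := by
  rw [jacobian_ofMap, Matrix.mulVec, dotProduct, map_sum]
  have h := congrFun (LinearMap.toMatrix'_mulVec
    (fderiv 𝕜 F x : (Fin D → 𝕜) →ₗ[𝕜] (Fin D → 𝕜)) fun j => MvPowerSeries.coeff m (X j)) i
  rw [ContinuousLinearMap.coe_coe] at h
  rw [← h, Matrix.mulVec, dotProduct]
  refine Finset.sum_congr rfl fun j _ => ?_
  rw [Matrix.map_apply, MvPowerSeries.coeff_C_mul]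

theorem jacobian_mulVec_eval_ofMap (Φ : FormalMap 𝕜 A D) (G : (Fin D → 𝕜) → (Fin D → 𝕜))
    (x : Fin D → 𝕜) (i : Fin D) (m : A →₀ ℕ) :
    MvPowerSeries.coeff m ((Φ.jacobian x).mulVec ((ofMap G).eval x) i) =
      fderiv 𝕜 (Φ m) x (G x) i := by
  rw [Matrix.mulVec, dotProduct, map_sum]
  have hG : G x = ∑ j, G x j • (Pi.single j 1 : Fin D → 𝕜) := by
    simpa using pi_eq_sum_univ' (G x)
  conv_rhs => rw [hG, map_sum, Finset.sum_apply]
  refine Finset.sum_congr rfl fun j _ => ?_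
  rw [eval_ofMap, MvPowerSeries.coeff_mul_C, map_smul, Pi.smul_apply, smul_eq_mul, mul_comm]
  rfl

end FormalMap

section Main

variable {𝕜 : Type*} [RCLike 𝕜] {A : Type*} {D d : ℕ} {f : A → (Fin D → 𝕜) → (Fin D → 𝕜)}
  {g : Fin d → (Fin D → 𝕜) → (Fin D → 𝕜)} {ν : Fin d → A → 𝕜}

theorem inv_mulVec_eq_of_mulVec_eq {R n : Type*} [CommRing R] [Fintype n] [DecidableEq n]
    {M : Matrix n n R} (hM : IsUnit M.det) {b c : n → R} (h : M.mulVec c = b) :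
    M⁻¹.mulVec b = c := by
  rw [← h, Matrix.mulVec_mulVec, Matrix.nonsing_inv_mul M hM, Matrix.one_mulVec]

theorem coeff_eval (Φ : FormalMap 𝕜 A D) (x : Fin D → 𝕜) (i : Fin D) (m : A →₀ ℕ) :
    MvPowerSeries.coeff m (Φ.eval x i) = Φ m x i := rfl

theorem differentiable_wordBasis (hf : ∀ l, ContDiff 𝕜 ∞ (f l)) (w : List A) :
    Differentiable 𝕜 (wordBasis f w) := by
  rw [wordBasis_eq_iterD]
  exact fun x => differentiableAt_of_contDiffOn isOpen_univ
    (contDiffOn_iterD hf isOpen_univ contDiff_id.contDiffOn w) (Set.mem_univ x)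

/-- The derivative of a word series along `g^v`. -/
theorem fderiv_wordSeries_gField (hf : ∀ l, ContDiff 𝕜 ∞ (f l)) (hg : ∀ j, ContDiff 𝕜 ∞ (g j))
    (heig : ∀ j l, VectorField.lieBracket 𝕜 (g j) (f l) = ν j l • f l) (v : Fin d → 𝕜)
    (δ : List A → 𝕜) (m : A →₀ ℕ) (x : Fin D → 𝕜) :
    fderiv 𝕜 (wordSeries f δ m) x (gField g v x) =
      ∑ w ∈ wordsOf m, δ w • iterD 𝕜 f w (gField g v) x + wordSeries f (xiOp ν v δ) m x := by
  have h : fderiv 𝕜 (wordSeries f δ m) x = ∑ w ∈ wordsOf m, δ w • fderiv 𝕜 (wordBasis f w) x :=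
    fderiv_sum_smul _ _ fun w _ => differentiable_wordBasis hf w x
  rw [h, sum_apply, wordSeries, ← Finset.sum_add_distrib]
  refine Finset.sum_congr rfl fun w _ => ?_
  have hid : (fun y => fderiv 𝕜 (id : (Fin D → 𝕜) → (Fin D → 𝕜)) y (gField g v y)) =
      gField g v := by
    funext y
    simp
  rw [smul_apply, wordBasis_eq_iterD, fderiv_iterD_gField hf hg heig v contDiff_id, hid, smul_add,
    smul_smul, xiOp, mul_comm]

/-- The Jacobian matrix of the word series of an element of `𝒢` is invertible. -/
theorem isUnit_det_jacobian_wordSeries {γ : List A → 𝕜} (hγ : γ [] = 1) (x : Fin D → 𝕜) :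
    IsUnit ((wordSeries f γ).jacobian x).det := by
  rw [MvPowerSeries.isUnit_iff_constantCoeff, RingHom.map_det]
  have : (MvPowerSeries.constantCoeff (σ := A) (R := 𝕜)).mapMatrix
      ((wordSeries f γ).jacobian x) = 1 := by
    ext i j
    have h0 : wordSeries f γ 0 = id := by
      funext y
      simp [wordSeries, wordsOf_zero, hγ, wordBasis]
    change fderiv 𝕜 (wordSeries f γ 0) x (Pi.single j 1) i = _
    rw [h0, fderiv_id, Matrix.one_apply]
    simp [Pi.single_apply]
  rw [this, Matrix.det_one]
  exact isUnit_one

/-- The series of differential operators with coefficients `Ξ_v δ` applied to the flow. -/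
theorem sum_XiOp_smul_iterD_timeOneFlow (hf : ∀ l, ContDiff 𝕜 ∞ (f l))
    (hg : ∀ j, ContDiff 𝕜 ∞ (g j))
    (heig : ∀ j l, VectorField.lieBracket 𝕜 (g j) (f l) = ν j l • f l) (v : Fin d → 𝕜)
    (δ : List A → 𝕜) {x : Fin D → 𝕜} (hx : x ∈ flowDomain (gField g v)) (m : A →₀ ℕ) :
    ∑ w ∈ wordsOf m, XiOp ν v δ w • iterD 𝕜 f w (timeOneFlow (gField g v)) x =
      wordSeries f δ m (timeOneFlow (gField g v) x) := by
  have hG := contDiff_gField hg v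
  refine Finset.sum_congr rfl fun w _ => ?_
  rw [iterD_of_transport (ν := ν) hf (isOpen_flowDomain hG)
    (fun y hy => (contDiffAt_timeOneFlow hG hy).contDiffWithinAt) v
    (fun l y hy => fderiv_timeOneFlow_apply_of_lieBracket_eq_smul hG (hf l)
      (lieBracket_gField hg heig v l) hy) w hx, XiOp, smul_smul]
  congr 1
  rw [mul_right_comm, ← NormedSpace.exp_add, add_neg_cancel, NormedSpace.exp_zero, one_mul]

end Main

end WordSeries

end

theorem proposition2 {𝕜 : Type*} [RCLike 𝕜] {A : Type*} {D d : ℕ}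
    (f : A → (Fin D → 𝕜) → (Fin D → 𝕜)) (g : Fin d → (Fin D → 𝕜) → (Fin D → 𝕜))
    (ν : Fin d → A → 𝕜)
    (hf : ∀ l, ContDiff 𝕜 ∞ (f l)) (hg : ∀ j, ContDiff 𝕜 ∞ (g j))
    (hindep : LinearIndependent 𝕜 g)
    (hcomm : ∀ j k, j ≠ k → VectorField.lieBracket 𝕜 (g j) (g k) = 0)
    (heig : ∀ j l, VectorField.lieBracket 𝕜 (g j) (f l) = ν j l • f l)
    (v : Fin d → 𝕜) :
    -- the flow at time one is a smooth map, with invertible derivative, on an open domain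
    (IsOpen (flowDomain (gField g v)) ∧
      ∀ x ∈ flowDomain (gField g v),
        ContDiffAt 𝕜 ∞ (timeOneFlow (gField g v)) x ∧
        IsUnit (FormalMap.jacobian
          (FormalMap.ofMap (timeOneFlow (gField g v)) : FormalMap 𝕜 A D) x).det) ∧
    (∀ β ∈ algebraG A 𝕜,
      (∀ x, FormalMap.bracket (FormalMap.ofMap (gField g v)) (wordSeries f β) x =
        (wordSeries f (xiOp ν v β)).eval x) ∧
      (∀ x ∈ flowDomain (gField g v),
        (FormalMap.jacobian (FormalMap.ofMap (timeOneFlow (gField g v))) x)⁻¹.mulVec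
            ((wordSeries f β).eval (timeOneFlow (gField g v) x)) =
          (wordSeries f (XiOp ν v β)).eval x)) ∧
    (∀ γ ∈ groupG A 𝕜,
      (∀ x ∈ flowDomain (gField g v),
        (wordSeries f γ).eval (timeOneFlow (gField g v) x) =
          substMap (timeOneFlow (gField g v)) ((wordSeries f (XiOp ν v γ)).eval x)) ∧
      (∀ x, IsUnit (FormalMap.jacobian (wordSeries f γ) x).det ∧
        (FormalMap.jacobian (wordSeries f γ) x)⁻¹.mulVec
            (substMap (gField g v) ((wordSeries f γ).eval x)) =
          (FormalMap.ofMap (gField g v)).eval x -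
            (FormalMap.jacobian (wordSeries f γ) x)⁻¹.mulVec
              ((wordSeries f (xiOp ν v γ)).eval x))) := by
  have hG := contDiff_gField hg v
  have hU := isOpen_flowDomain hG
  have hφ : ContDiffOn 𝕜 ∞ (timeOneFlow (gField g v)) (flowDomain (gField g v)) :=
    fun y hy => (contDiffAt_timeOneFlow hG hy).contDiffWithinAt
  have hdet : ∀ x ∈ flowDomain (gField g v), IsUnit (FormalMap.jacobian
      (FormalMap.ofMap (timeOneFlow (gField g v)) : FormalMap 𝕜 A D) x).det := fun x hx =>
    FormalMap.isUnit_det_jacobian_ofMap (fderiv_timeOneFlow_injective hG hx)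
  refine ⟨⟨hU, fun x hx => ⟨contDiffAt_timeOneFlow hG hx, hdet x hx⟩⟩,
    fun β hβ => ⟨fun x => ?_, fun x hx => ?_⟩, fun γ hγ => ⟨fun x hx => ?_, fun x => ?_⟩⟩
  · funext i
    ext m
    have h := sum_smul_iterD_of_mem_algebraG hf isOpen_univ hG.contDiffOn (Set.mem_univ x) hβ m
    rw [FormalMap.bracket, Pi.sub_apply, map_sub, FormalMap.jacobian_mulVec_eval_ofMap,
      FormalMap.jacobian_ofMap_mulVec, fderiv_wordSeries_gField hf hg heig, h, Pi.add_apply]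
    exact add_sub_cancel_left _ _
  · refine inv_mulVec_eq_of_mulVec_eq (hdet x hx) ?_
    funext i
    ext m
    have h := sum_smul_iterD_of_mem_algebraG hf hU hφ hx (XiOp_mem_algebraG ν v hβ) m
    rw [sum_XiOp_smul_iterD_timeOneFlow hf hg heig v β hx] at h
    rw [FormalMap.jacobian_ofMap_mulVec, coeff_eval, h]
    rfl
  · funext i
    ext m
    rw [coeff_eval, ← sum_XiOp_smul_iterD_timeOneFlow hf hg heig v γ hx m]
    exact (substMap_wordSeries hf hU hφ hx (XiOp_mem_groupG ν v hγ) i m).symm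
  · have hunit := isUnit_det_jacobian_wordSeries (f := f) hγ.1 x
    refine ⟨hunit, ?_⟩
    rw [eq_sub_iff_add_eq, ← Matrix.mulVec_add]
    refine inv_mulVec_eq_of_mulVec_eq hunit ?_
    funext i
    ext m
    rw [FormalMap.jacobian_mulVec_eval_ofMap, fderiv_wordSeries_gField hf hg heig, Pi.add_apply,
      Pi.add_apply, map_add, coeff_eval,
      ← substMap_wordSeries hf isOpen_univ hG.contDiffOn (Set.mem_univ x) hγ]
    rfl
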